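/- Let $\theta>0$ and let $\omega(dz)=z^{-1}(1-z)^{\theta-1}\,dz$ on $[0,1]$. Let $\{(\tau_j,\xi_j)\}$ be the random set of atoms of a Poisson point process on $[0,\infty)\times[0,1]$ with intensity measure $\mathrm{Lebesgue}\times\omega$, put $S_t=1-\prod_{j:\,\tau_j\le t}(1-\xi_j)$ for $t>0$, and let $U_g=[0,1]\setminus\overline{\{S_t:t>0\}}$. For a composition $\lambda=(\lambda_1,\dots,\lambda_\ell)$ of $n$ (an ordered list of positive integers with sum $n$) put $\Lambda_j=\lambda_j+\cdots+\lambda_\ell$ and $$g(\lambda)=\frac{n!}{[\theta]_n}\prod_{j=1}^{\ell}\frac{1}{\lambda_j\,h_\theta(\Lambda_j)},\qquad h_\theta(k)=\sum_{i=1}^{k}\frac{1}{\theta+i-1},\qquad [\theta]_n=\theta(\theta+1)\cdots(\theta+n-1).$$ Then: (i) $U_g$ is a paintbox, i.e. a (almost surely open) random open subset of $[0,1]$. (ii) $g$ is a composition structure: $g\ge 0$; for each $n$ the values $g(\lambda)$ over compositions $\lambda$ of $n$ sum to $1$; and if a ball chosen uniformly at random is removed from a random composition of $n+1$ with law $g$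 (a box that becomes empty being dropped), the resulting composition of $n$ has law $g$. (iii) $U_g$ represents $g$: if $n$ independent uniform points of $[0,1]$ are sampled independently of $U_g$, and are grouped into the blocks of the ordered partition of $[0,1]$ whose blocks are the component intervals of $U_g$ and the single points of its complement, then the composition of $n$ formed by the nonzero occupancy numbers of the blocks, from left to right, equals $\lambda$ with probability $g(\lambda)$, for every $n$ and every composition $\lambda$ of $n$. (iv) $g$ has the product form $g(\lambda)=\prod_{j=1}^{\ell}q(\Lambda_j:\lambda_j)$, where $q(n:m)=w(n:m)\big/\sum_{k=1}^{n}w(n:k)$ and $w(n:m)=\binom nm\int_0^1 z^m(1-z)^{n-m}\,\omega(dz)$ for $1\le m\le n$. -/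

import Mathlib

open MeasureTheory ProbabilityTheory Set

noncomputable section

namespace SamplingFormula

/-! ### Compositions and composition structures -/

/-- The tail sum `Λ_j = λ_j + ⋯ + λ_ℓ` of an integer composition. -/
def tailSum {n : ℕ} (c : Composition n) (j : Fin c.length) : ℕ :=
  ∑ i ∈ Finset.Ici j, c.blocksFun i

/-- Remove one ball from the `j`-th box, and drop the box if it becomes empty. -/
def removeBall (l : List ℕ) (j : ℕ) : List ℕ :=
  (l.modify j (fun a => a - 1)).filter (fun a => a ≠ 0)

/-- A function `q` on compositions of integers is a composition structure: for each `n` its values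
on the compositions of `n` form a probability distribution, and removing a uniformly random ball
from a random composition of `n + 1` with law `q (n + 1)` gives a composition with law `q n`
(the ball is in the `j`-th box of `d` with probability `d_j / (n + 1)`). -/
structure IsCompositionStructure (q : (n : ℕ) → Composition n → ℝ) : Prop where
  nonneg : ∀ (n : ℕ) (c : Composition n), 0 ≤ q n c
  sum_eq_one : ∀ n : ℕ, ∑ c : Composition n, q n c = 1
  consistent : ∀ (n : ℕ) (c : Composition n),
    q n c = ∑ d : Composition (n + 1), ∑ j : Fin d.length,
      if removeBall d.blocks j = c.blocks then q (n + 1) d * ((d.blocksFun j : ℝ) / (n + 1)) else 0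

/-- The generalised harmonic number `h_θ(n) = ∑_{k=1}^n 1/(θ+k-1)`. -/
def genHarmonic (θ : ℝ) (n : ℕ) : ℝ :=
  ∑ k ∈ Finset.Icc 1 n, 1 / (θ + (k : ℝ) - 1)

/-- The sampling formula `g(λ) = n!/[θ]_n ∏_j 1/(λ_j h_θ(Λ_j))`. -/
def gFormula (θ : ℝ) (n : ℕ) (c : Composition n) : ℝ :=
  (n.factorial : ℝ) / (ascPochhammer ℝ n).eval θ *
    ∏ j : Fin c.length, 1 / ((c.blocksFun j : ℝ) * genHarmonic θ (tailSum c j))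

/-! ### Binomial moments and the product form -/

/-- The binomial moment `w(n:m) = C(n,m) ∫ z^m (1-z)^(n-m) dω(z)`. -/
def binomialMoment (ω : Measure ℝ) (n m : ℕ) : ℝ :=
  (n.choose m : ℝ) * ∫ z, z ^ m * (1 - z) ^ (n - m) ∂ω

/-- `q(n:m) = w(n:m) / (w(n:1) + ⋯ + w(n:n))`. -/
def decrement (ω : Measure ℝ) (n m : ℕ) : ℝ :=
  binomialMoment ω n m / ∑ k ∈ Finset.Icc 1 n, binomialMoment ω n k

/-! ### Paintboxes and sampling from them -/

/-- Two points are in the same block of the ordered partition of `[0,1]` into the component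
intervals of `U` and the singletons of the complement of `U`. -/
def SameBlock (U : Set ℝ) (x y : ℝ) : Prop :=
  x = y ∨ uIcc x y ⊆ U

/-- The leftmost sample point in the block of the `i`-th sample point. -/
def leftmost (U : Set ℝ) {n : ℕ} (x : Fin n → ℝ) (i : Fin n) : ℝ :=
  sInf (x '' {j | SameBlock U (x i) (x j)})

/-- The occupancy numbers of the blocks that contain at least one sample point, listed from the
left to the right. (A block is labelled by its leftmost sample point.) -/
def sampleComposition (U : Set ℝ) {n : ℕ} (x : Fin n → ℝ) : Composition n where
  blocks := ((Finset.univ.image (leftmost U x)).sort).map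
    (fun a => (Finset.univ.filter (fun i => leftmost U x i = a)).card)
  blocks_pos := by
    intro k hk
    simp only [List.mem_map, Finset.mem_sort, Finset.mem_image, Finset.mem_univ, true_and] at hk
    obtain ⟨a, ⟨i, hi⟩, rfl⟩ := hk
    exact Finset.card_pos.mpr ⟨i, by simp [hi]⟩
  blocks_sum := by
    have h := Finset.card_eq_sum_card_image (leftmost U x) (Finset.univ : Finset (Fin n))
    rw [Finset.card_univ, Fintype.card_fin, ← Finset.sum_map_toList] at h
    exact ((Finset.sort_perm_toList _ _).map _).sum_eq.trans h.symm

/-- The uniform distribution on `[0,1]`. -/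
def unifLaw : Measure ℝ := volume.restrict (Icc 0 1)

/-- A paintbox on `(Ω, P)`: a random open subset of `[0,1]`. Measurability is with respect to
the σ-algebra on open sets that is generated by the events `[a,b] ⊆ U`. -/
structure IsPaintbox {Ω : Type*} [MeasurableSpace Ω] (P : Measure Ω) (U : Ω → Set ℝ) : Prop where
  isOpen : ∀ᵐ ω ∂P, IsOpen (U ω)
  subset : ∀ᵐ ω ∂P, U ω ⊆ Icc 0 1
  measurable : ∀ a b : ℝ, NullMeasurableSet {ω | Icc a b ⊆ U ω} P

/-- The event, on the product of `Ω` with the space of samples of size `n`, that the sample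
induces the composition `c`. -/
def sampleEvent {Ω : Type*} (U : Ω → Set ℝ) (n : ℕ) (c : Composition n) :
    Set (Ω × (Fin n → ℝ)) :=
  {z | sampleComposition (U z.1) z.2 = c}

/-- `U` represents `q`: for every `n`, if `n` independent uniform points of `[0,1]` are sampled
independently of `U`, then the induced random composition has law `q n`. -/
structure Represents {Ω : Type*} [MeasurableSpace Ω] (P : Measure Ω) (U : Ω → Set ℝ)
    (q : (n : ℕ) → Composition n → ℝ) : Prop where
  measurable : ∀ (n : ℕ) (c : Composition n),
    NullMeasurableSet (sampleEvent U n c) (P.prod (Measure.pi fun _ : Fin n => unifLaw))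
  prob_eq : ∀ (n : ℕ) (c : Composition n),
    (P.prod (Measure.pi fun _ : Fin n => unifLaw)) (sampleEvent U n c) = ENNReal.ofReal (q n c)

/-! ### The Poisson process and the geometric subordinator -/

/-- `X` is (the random set of atoms of) a Poisson point process on `E` with intensity measure `μ`:
a random countable set whose numbers of points in disjoint measurable sets are independent, the
number of points in `A` being Poisson with mean `μ A` (almost surely infinite if `μ A = ∞`).
Only intensities without atoms are meant, so that no point is multiple. -/
structure IsPoissonProcess {Ω E : Type*} [MeasurableSpace Ω] [MeasurableSpace E]
    (P : Measure Ω) (X : Ω → Set E) (μ : Measure E) : Prop where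
  countable : ∀ᵐ ω ∂P, (X ω).Countable
  measurable_count : ∀ A : Set E, MeasurableSet A → Measurable fun ω => (X ω ∩ A).encard
  law_count : ∀ A : Set E, MeasurableSet A → μ A ≠ ⊤ →
    P.map (fun ω => (X ω ∩ A).encard) =
      (poissonMeasure (μ A).toNNReal).map (fun k : ℕ => (k : ℕ∞))
  count_eq_top : ∀ A : Set E, MeasurableSet A → μ A = ⊤ → ∀ᵐ ω ∂P, (X ω ∩ A).encard = ⊤
  indep_count : ∀ (n : ℕ) (A : Fin n → Set E), (∀ i, MeasurableSet (A i)) →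
    Pairwise (fun i j => Disjoint (A i) (A j)) → iIndepFun (fun i ω => (X ω ∩ A i).encard) P

/-- The measure `z⁻¹ (1-z)^(θ-1) dz` on `[0,1]`. -/
def breakMeasure (θ : ℝ) : Measure ℝ :=
  (volume.restrict (Ioo 0 1)).withDensity
    (fun z => ENNReal.ofReal (z⁻¹ * (1 - z) ^ (θ - 1)))

/-- The intensity `Lebesgue × z⁻¹ (1-z)^(θ-1) dz` on the strip `[0,∞) × [0,1]`. -/
def stripIntensity (θ : ℝ) : Measure (ℝ × ℝ) :=
  (volume.restrict (Ici 0)).prod (breakMeasure θ)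

/-- `S_t = 1 - ∏_{τ_j ≤ t} (1 - ξ_j)`, the product over all atoms `(τ_j, ξ_j)` of `X` with
`τ_j ≤ t`. (For atoms in the strip the finite partial products decrease along inclusion and are
bounded below, so the unordered infinite product exists.) -/
def subordinator (X : Set (ℝ × ℝ)) (t : ℝ) : ℝ :=
  1 - ∏' p : {p : ℝ × ℝ // p ∈ X ∧ p.1 ≤ t}, (1 - p.1.2)

/-- The complement in `[0,1]` of the closure of the range `{S_t : t > 0}`. -/
def rangeComplement (X : Set (ℝ × ℝ)) : Set ℝ :=
  Icc 0 1 \ closure (subordinator X '' Ioi 0)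

end SamplingFormula

end

/-!
Sampling from the complement of the range of the subordinator `S` is regenerative: whatever lies to
the right of a jump looks like the whole picture again. This makes the composition structure a
product of the decrement probabilities `q(Λ_j : λ_j)`, and the beta integrals
`∫ z^a (1-z)^b dω` turn the product into the explicit formula.

*Algebra.* By `integral_one_sub_one_sub_pow` the Laplace exponent `∫ (1 - (1-z)^n) dω` is the
generalised harmonic number `h_θ(n)`, and it is also the sum of the binomial moments of order `n`;
this gives the product form. The consistency of `g` under removal of a ball is an induction on the
first box (`sum_addBall_harmonicWeight`), based on `h_θ(n+1) = h_θ(n) + 1/(θ+n)`. That the values of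
`g` add up to `1` follows from the consistency by induction on `n`.

*Paths.* The Laplace functional `E ∏ f = exp (-∫ (1-f) dμ)` (`IsPoissonProcess.laplace`) gives the
joint moments of the survival factors `∏ (1-ξ)` over disjoint time sets
(`integral_prod_polynomial_survival`), and shows that almost every realization is regular
(`ae_isRegular`): `S` increases from `0` to `1` and stays below `1`. Positivity of `1 - S` makes the
path right-continuous (`IsRegular.exists_lt_add`), which settles all questions of measurability,
because countably many times then suffice.

*Sampling.* The event that the sample falls into given cells `(S_{k/(m+1)}, S_{(k+1)/(m+1)}]`,
grouped as prescribed by a composition `λ`, has an explicit probability. Its sum over the positions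
of the cells is a product of geometric series, and as `m → ∞` it tends to `g(λ)`, since in a short time
`1/(m+1)` only single atoms matter (`tendsto_polyMean_div`). On the other hand, two sample points in
different blocks are almost surely separated by a value of the path: otherwise one of them would be
an endpoint of a gap of the closed range, and there are only countably many of those
(`ae_exists_mem_Ioo_of_mem_closure`). So on fine grids the cells carry the composition of the sample
(`sampleComposition_eq_of_frequently`), and its probability of being `λ` is at least `g(λ)`. As the
`g(λ)` add up to `1`, equality holds, and the null-measurability of the sampling events comes with
it (`measure_preimage_eq_of_sum_eq_one`).
-/

noncomputable section

namespace SamplingFormula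

open Filter Topology

/-! ### Infinite products over a random set of atoms -/

section AtomProduct

variable {E : Type*}

/-- The product `∏_{p ∈ S} f p` over all points of a set, as an unordered infinite product. -/
def atomProduct (S : Set E) (f : E → ℝ) : ℝ := ∏' p : S, f p

variable {S : Set E} {f g : E → ℝ}

theorem prod_antitone_of_le_one (h0 : ∀ p, 0 ≤ f p) (h1 : ∀ p, f p ≤ 1) :
    Antitone (fun F : Finset S => ∏ p ∈ F, f p) := fun F G hFG => by
  classical
  change ∏ p ∈ G, f p ≤ ∏ p ∈ F, f p
  rw [← Finset.prod_sdiff hFG]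
  exact mul_le_of_le_one_left (Finset.prod_nonneg fun p _ => h0 p)
    (Finset.prod_le_one (fun p _ => h0 p) fun p _ => h1 p)

theorem hasProd_atomProduct (h0 : ∀ p, 0 ≤ f p) (h1 : ∀ p, f p ≤ 1) :
    HasProd (fun p : S => f p) (atomProduct S f) := by
  have hb : BddBelow (range fun F : Finset S => ∏ p ∈ F, f p) :=
    ⟨0, by rintro _ ⟨F, rfl⟩; exact Finset.prod_nonneg fun p _ => h0 p⟩
  have h : HasProd (fun p : S => f p) (⨅ F : Finset S, ∏ p ∈ F, f p) :=
    tendsto_atTop_ciInf (prod_antitone_of_le_one h0 h1) hb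
  exact h.multipliable.hasProd

theorem atomProduct_le_prod (h0 : ∀ p, 0 ≤ f p) (h1 : ∀ p, f p ≤ 1) (F : Finset S) :
    atomProduct S f ≤ ∏ p ∈ F, f p := by
  refine le_of_tendsto (hasProd_atomProduct h0 h1) ?_
  filter_upwards [eventually_ge_atTop F] with G hG
  exact prod_antitone_of_le_one h0 h1 hG

theorem atomProduct_nonneg (h0 : ∀ p, 0 ≤ f p) (h1 : ∀ p, f p ≤ 1) : 0 ≤ atomProduct S f :=
  ge_of_tendsto (hasProd_atomProduct h0 h1)
    (Eventually.of_forall fun _ => Finset.prod_nonneg fun p _ => h0 p)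

theorem atomProduct_le_one (h0 : ∀ p, 0 ≤ f p) (h1 : ∀ p, f p ≤ 1) : atomProduct S f ≤ 1 := by
  simpa using atomProduct_le_prod h0 h1 (∅ : Finset S)

theorem exists_prod_lt_of_atomProduct_lt (h0 : ∀ p, 0 ≤ f p) (h1 : ∀ p, f p ≤ 1) {c : ℝ}
    (h : atomProduct S f < c) : ∃ F : Finset S, ∏ p ∈ F, f p < c :=
  ((hasProd_atomProduct h0 h1).eventually (gt_mem_nhds h)).exists

theorem atomProduct_mono (h0 : ∀ p, 0 ≤ f p) (h : ∀ p, f p ≤ g p) (h1 : ∀ p, g p ≤ 1) :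
    atomProduct S f ≤ atomProduct S g :=
  le_of_tendsto_of_tendsto
    (hasProd_atomProduct h0 fun p => (h p).trans (h1 p))
    (hasProd_atomProduct (fun p => (h0 p).trans (h p)) h1)
    (Eventually.of_forall fun _ => Finset.prod_le_prod (fun p _ => h0 p) fun p _ => h p)

theorem atomProduct_mul (h0 : ∀ p, 0 ≤ f p) (h1 : ∀ p, f p ≤ 1) (k0 : ∀ p, 0 ≤ g p)
    (k1 : ∀ p, g p ≤ 1) :
    atomProduct S (fun p => f p * g p) = atomProduct S f * atomProduct S g :=
  ((hasProd_atomProduct h0 h1).mul (hasProd_atomProduct k0 k1)).tprod_eq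

theorem atomProduct_finset_prod {ι : Type*} (s : Finset ι) (φ : ι → E → ℝ)
    (h0 : ∀ i p, 0 ≤ φ i p) (h1 : ∀ i p, φ i p ≤ 1) :
    atomProduct S (fun p => ∏ i ∈ s, φ i p) = ∏ i ∈ s, atomProduct S (φ i) :=
  (hasProd_prod fun i _ => hasProd_atomProduct (h0 i) (h1 i)).tprod_eq

theorem atomProduct_pow (h0 : ∀ p, 0 ≤ f p) (h1 : ∀ p, f p ≤ 1) (n : ℕ) :
    atomProduct S (fun p => f p ^ n) = atomProduct S f ^ n := by
  simpa using atomProduct_finset_prod (S := S) (Finset.range n) (fun _ => f)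
    (fun _ => h0) (fun _ => h1)

theorem atomProduct_rpow (h0 : ∀ p, 0 ≤ f p) (h1 : ∀ p, f p ≤ 1) {s : ℝ} (hs : 0 ≤ s) :
    atomProduct S (fun p => f p ^ s) = atomProduct S f ^ s := by
  have h : HasProd (fun p : S => f p ^ s) (atomProduct S f ^ s) := by
    have := (hasProd_atomProduct (S := S) h0 h1).rpow_const (p := s) (Or.inr hs)
    refine Tendsto.congr (fun F => ?_) this
    exact (Real.finsetProd_rpow F (fun p : S => f p) (fun p _ => h0 p) s).symm
  exact h.tprod_eq

open Classical in
theorem atomProduct_ite_const (A : Set E) (c : ℝ) (hA : (S ∩ A).encard ≠ ⊤) :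
    atomProduct S (fun p => if p ∈ A then c else 1) = c ^ (S ∩ A).encard.toNat := by
  have hfin : (S ∩ A).Finite := by
    by_contra h
    exact hA (Set.encard_eq_top_iff.mpr h)
  have hfin' : {p : S | (p : E) ∈ A}.Finite := by
    refine Set.Finite.of_finite_image (f := Subtype.val) (hfin.subset ?_)
      Subtype.val_injective.injOn
    rintro _ ⟨p, hp, rfl⟩
    exact ⟨p.2, hp⟩
  have h : HasProd (fun p : S => if (p : E) ∈ A then c else 1)
      (∏ p ∈ hfin'.toFinset, if (p : E) ∈ A then c else 1) :=
    hasProd_prod_of_ne_finset_one fun p hp => by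
      have : (p : E) ∉ A := by simpa using hp
      simp [this]
  rw [atomProduct, h.tprod_eq, Finset.prod_congr rfl (g := fun _ => c), Finset.prod_const]
  · congr 1
    have himg : S ∩ A = Subtype.val '' {p : S | (p : E) ∈ A} := by
      ext x; simp [and_comm]
    rw [himg, Subtype.val_injective.encard_image, hfin'.encard_eq_coe_toFinset_card]
    rfl
  · intro p hp
    have : (p : E) ∈ A := by simpa using hp
    simp [this]

end AtomProduct

/-! ### Rounding up to multiples of `1 / (r + 1)` -/

section Grid

variable {E : Type*}

/-- The upper approximation of `x ∈ [0,1]` by a multiple of `1 / (r + 1)`. -/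
def gridCeil (r : ℕ) (x : ℝ) : ℝ := (⌈(r + 1 : ℝ) * x⌉₊ : ℝ) / (r + 1)

theorem le_gridCeil (r : ℕ) (x : ℝ) : x ≤ gridCeil r x := by
  rw [gridCeil, le_div_iff₀ (by positivity), mul_comm]
  exact Nat.le_ceil _

theorem gridCeil_le_one (r : ℕ) {x : ℝ} (h1 : x ≤ 1) : gridCeil r x ≤ 1 := by
  rw [gridCeil, div_le_one (by positivity)]
  have : ⌈(r + 1 : ℝ) * x⌉₊ ≤ r + 1 := by
    rw [Nat.ceil_le]; push_cast; nlinarith [(Nat.cast_nonneg r : (0 : ℝ) ≤ r)]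
  exact_mod_cast this

theorem gridCeil_nonneg (r : ℕ) (x : ℝ) : 0 ≤ gridCeil r x := by
  rw [gridCeil]; positivity

theorem tendsto_gridCeil {x : ℝ} (h0 : 0 ≤ x) :
    Tendsto (fun r => gridCeil r x) atTop (𝓝 x) := by
  have hz : Tendsto (fun r : ℕ => x + 1 / ((r : ℝ) + 1)) atTop (𝓝 x) := by
    simpa using tendsto_const_nhds.add (tendsto_one_div_add_atTop_nhds_zero_nat (𝕜 := ℝ))
  refine tendsto_of_tendsto_of_tendsto_of_le_of_le tendsto_const_nhds hz
    (fun r => le_gridCeil r x) fun r => ?_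
  have hr : (0 : ℝ) < r + 1 := by positivity
  have := (Nat.ceil_lt_add_one (a := (r + 1 : ℝ) * x) (by positivity)).le
  change (⌈(r + 1 : ℝ) * x⌉₊ : ℝ) / (r + 1) ≤ x + 1 / (r + 1)
  rw [div_le_iff₀ hr, add_mul x, div_mul_cancel₀ _ hr.ne', mul_comm x]
  exact this

/-- The set where the grid approximation of `f` takes the value `i / (r + 1)`. -/
def gridLevel (f : E → ℝ) (r i : ℕ) : Set E := {p | ⌈(r + 1 : ℝ) * f p⌉₊ = i}

theorem disjoint_gridLevel (f : E → ℝ) (r : ℕ) {i j : ℕ} (h : i ≠ j) :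
    Disjoint (gridLevel f r i) (gridLevel f r j) :=
  Set.disjoint_left.mpr fun _ hi hj => h ((show _ = i from hi).symm.trans hj)

open Classical in
theorem gridCeil_eq_prod {f : E → ℝ} (h1 : ∀ p, f p ≤ 1) (r : ℕ) (p : E) :
    gridCeil r (f p)
      = ∏ i : Fin (r + 1), if p ∈ gridLevel f r i then (i : ℝ) / (r + 1) else 1 := by
  by_cases h : ⌈(r + 1 : ℝ) * f p⌉₊ < r + 1
  · rw [Finset.prod_eq_single ⟨_, h⟩]
    · simp [gridLevel, gridCeil]
    · intro i _ hi
      rw [if_neg]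
      intro hp
      exact hi (Fin.ext (show _ = (i : ℕ) from hp).symm)
    · simp
  · have h2 : gridCeil r (f p) = 1 := by
      refine le_antisymm (gridCeil_le_one r (h1 p)) ?_
      rw [gridCeil, le_div_iff₀ (by positivity), one_mul]
      exact_mod_cast not_lt.mp h
    rw [h2, Finset.prod_eq_one]
    intro i _
    rw [if_neg]
    intro hp
    exact h ((show _ = (i : ℕ) from hp) ▸ i.2)

theorem one_sub_gridCeil_eq_sum {f : E → ℝ} (h1 : ∀ p, f p ≤ 1) (r : ℕ) (p : E) :
    1 - gridCeil r (f p)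
      = ∑ i : Fin (r + 1), (gridLevel f r i).indicator (fun _ => 1 - (i : ℝ) / (r + 1)) p := by
  by_cases h : ⌈(r + 1 : ℝ) * f p⌉₊ < r + 1
  · rw [Finset.sum_eq_single ⟨_, h⟩]
    · simp [gridLevel, gridCeil, Set.indicator]
    · intro i _ hi
      rw [Set.indicator_of_notMem]
      intro hp
      exact hi (Fin.ext (show _ = (i : ℕ) from hp).symm)
    · simp
  · have h2 : gridCeil r (f p) = 1 := by
      refine le_antisymm (gridCeil_le_one r (h1 p)) ?_
      rw [gridCeil, le_div_iff₀ (by positivity), one_mul]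
      exact_mod_cast not_lt.mp h
    rw [h2, sub_self, Finset.sum_eq_zero]
    intro i _
    rw [Set.indicator_of_notMem]
    intro hp
    exact h ((show _ = (i : ℕ) from hp) ▸ i.2)

end Grid

/-! ### The Laplace functional of a Poisson process -/

section Laplace

/-- The probability generating function of the Poisson law. -/
theorem integral_pow_poissonMeasure (r : NNReal) (c : ℝ) :
    ∫ k : ℕ, c ^ k ∂(poissonMeasure r) = Real.exp (-(r * (1 - c))) := by
  rw [integral_poissonMeasure]
  have h : ∀ n : ℕ, (Real.exp (-r) * (r : ℝ) ^ n / n.factorial) • c ^ n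
      = Real.exp (-r) * ((r * c) ^ n / n.factorial) := fun n => by
    rw [smul_eq_mul, mul_pow]; ring
  simp_rw [h]
  rw [tsum_mul_left]
  have h2 : ∑' n : ℕ, ((r : ℝ) * c) ^ n / n.factorial = Real.exp (r * c) := by
    rw [Real.exp_eq_exp_ℝ, NormedSpace.exp_eq_tsum_div]
  rw [h2, ← Real.exp_add]
  congr 1; ring

variable {Ω E : Type*} [MeasurableSpace Ω] [MeasurableSpace E] {P : Measure Ω}
  {X : Ω → Set E} {μ : Measure E}

theorem IsPoissonProcess.ae_count_ne_top (hX : IsPoissonProcess P X μ) {A : Set E}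
    (hA : MeasurableSet A) (hμ : μ A ≠ ⊤) : ∀ᵐ ω ∂P, (X ω ∩ A).encard ≠ ⊤ := by
  have hm := hX.measurable_count A hA
  have h : P.map (fun ω => (X ω ∩ A).encard) {⊤} = 0 := by
    rw [hX.law_count A hA hμ, Measure.map_apply (measurable_from_top) (measurableSet_singleton _)]
    have : (fun k : ℕ => (k : ℕ∞)) ⁻¹' {⊤} = ∅ := by ext k; simp
    rw [this, measure_empty]
  rw [Measure.map_apply hm (measurableSet_singleton _)] at h
  rw [ae_iff]
  simp only [not_not]
  exact h

theorem IsPoissonProcess.integral_pow_count (hX : IsPoissonProcess P X μ) {A : Set E}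
    (hA : MeasurableSet A) (hμ : μ A ≠ ⊤) (c : ℝ) :
    ∫ ω, c ^ (X ω ∩ A).encard.toNat ∂P = Real.exp (-((μ A).toReal * (1 - c))) := by
  have hm := hX.measurable_count A hA
  rw [← integral_map (f := fun k : ℕ∞ => c ^ k.toNat) (φ := fun ω => (X ω ∩ A).encard)
    hm.aemeasurable (by exact (measurable_from_top).aestronglyMeasurable), hX.law_count A hA hμ,
    integral_map (by exact measurable_from_top.aemeasurable)
      (by exact (measurable_from_top).aestronglyMeasurable)]
  exact integral_pow_poissonMeasure (μ A).toNNReal c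

theorem IsPoissonProcess.integral_prod_pow_count (hX : IsPoissonProcess P X μ) {n : ℕ}
    {A : Fin n → Set E} (hA : ∀ i, MeasurableSet (A i))
    (hd : Pairwise (fun i j => Disjoint (A i) (A j))) (hμ : ∀ i, μ (A i) ≠ ⊤) (c : Fin n → ℝ) :
    ∫ ω, ∏ i, c i ^ (X ω ∩ A i).encard.toNat ∂P
      = Real.exp (-∑ i, (μ (A i)).toReal * (1 - c i)) := by
  have h := (hX.indep_count n A hA hd).integral_fun_prod_comp
    (f := fun i (k : ℕ∞) => c i ^ k.toNat)
    (fun i => (hX.measurable_count _ (hA i)).aemeasurable)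
    (fun i => by exact (measurable_from_top).aestronglyMeasurable)
  rw [h, ← Finset.sum_neg_distrib, Real.exp_sum]
  exact Finset.prod_congr rfl fun i _ => hX.integral_pow_count (hA i) (hμ i) (c i)

theorem measurableSet_gridLevel {f : E → ℝ} (hf : Measurable f) (r i : ℕ) :
    MeasurableSet (gridLevel f r i) :=
  (Nat.measurable_ceil.comp (hf.const_mul _)) (measurableSet_singleton i)

theorem measure_gridLevel_ne_top {f : E → ℝ} (h1 : ∀ p, f p ≤ 1)
    (hint : Integrable (fun p => 1 - f p) μ) (r : ℕ) (i : Fin (r + 1)) :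
    μ (gridLevel f r i) ≠ ⊤ := by
  have hpos : (0 : ℝ) < 1 / (r + 1) := by positivity
  refine ne_top_of_le_ne_top (hint.measure_norm_ge_lt_top hpos).ne (measure_mono fun p hp => ?_)
  have hp' : ⌈(r + 1 : ℝ) * f p⌉₊ = (i : ℕ) := hp
  have hr : (0 : ℝ) < r + 1 := by positivity
  have h2 : (r + 1 : ℝ) * f p ≤ r := by
    refine (Nat.le_ceil _).trans ?_
    rw [hp']
    exact_mod_cast Nat.lt_succ_iff.mp i.2
  change 1 / (r + 1 : ℝ) ≤ ‖1 - f p‖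
  rw [Real.norm_of_nonneg (by linarith [h1 p]), div_le_iff₀ hr]
  nlinarith

/-- The **Laplace functional** of a Poisson process: for `0 ≤ f ≤ 1` with `1 - f` integrable,
`E ∏_{p ∈ X} f p = exp (-∫ (1 - f) dμ)`. The function `f` is rounded up to multiples of
`1 / (r + 1)`, which turns the product into finitely many powers of independent Poisson counts. -/
theorem IsPoissonProcess.laplace [IsProbabilityMeasure P] (hX : IsPoissonProcess P X μ)
    {f : E → ℝ} (hf : Measurable f) (h0 : ∀ p, 0 ≤ f p) (h1 : ∀ p, f p ≤ 1)
    (hint : Integrable (fun p => 1 - f p) μ) :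
    AEMeasurable (fun ω => atomProduct (X ω) f) P ∧
      ∫ ω, atomProduct (X ω) f ∂P = Real.exp (-∫ p, (1 - f p) ∂μ) := by
  classical
  set Y : ℕ → Ω → ℝ := fun r ω =>
    ∏ i : Fin (r + 1), ((i : ℝ) / (r + 1)) ^ (X ω ∩ gridLevel f r i).encard.toNat with hY
  have hYm : ∀ r, Measurable (Y r) := fun r =>
    Finset.measurable_prod _ fun i _ =>
      (measurable_from_top (f := fun k : ℕ∞ => ((i : ℝ) / (r + 1)) ^ k.toNat)).comp
        (hX.measurable_count _ (measurableSet_gridLevel hf r i))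
  have hY0 : ∀ r ω, 0 ≤ Y r ω := fun r ω => Finset.prod_nonneg fun i _ => by positivity
  have hY1 : ∀ r ω, Y r ω ≤ 1 := fun r ω =>
    Finset.prod_le_one (fun i _ => by positivity) fun i _ =>
      pow_le_one₀ (by positivity) (by
        rw [div_le_one (by positivity)]
        exact_mod_cast i.2.le)
  have hfin : ∀ᵐ ω ∂P, ∀ r : ℕ, ∀ i : Fin (r + 1), (X ω ∩ gridLevel f r i).encard ≠ ⊤ := by
    rw [ae_all_iff]; intro r
    rw [ae_all_iff]; intro i
    exact hX.ae_count_ne_top (measurableSet_gridLevel hf r i)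
      (measure_gridLevel_ne_top h1 hint r i)
  have hYeq : ∀ᵐ ω ∂P, ∀ r, Y r ω = atomProduct (X ω) (fun p => gridCeil r (f p)) := by
    filter_upwards [hfin] with ω hω r
    have : (fun p => gridCeil r (f p)) = fun p => ∏ i : Fin (r + 1),
        if p ∈ gridLevel f r i then (i : ℝ) / (r + 1) else 1 :=
      funext (gridCeil_eq_prod h1 r)
    rw [this, atomProduct_finset_prod]
    · exact Finset.prod_congr rfl fun i _ => (atomProduct_ite_const _ _ (hω r i)).symm
    · intro i p; split_ifs <;> positivity
    · intro i p; split_ifs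
      · rw [div_le_one (by positivity)]
        exact_mod_cast i.2.le
      · exact le_rfl
  have hlim : ∀ᵐ ω ∂P, Tendsto (fun r => Y r ω) atTop (𝓝 (atomProduct (X ω) f)) := by
    filter_upwards [hYeq] with ω hω
    simp_rw [hω]
    rw [Metric.tendsto_atTop]
    -- rounding up only increases the product, and a finite partial product bounds it from above
    intro ε hε
    obtain ⟨F, hF⟩ := exists_prod_lt_of_atomProduct_lt h0 h1 (lt_add_of_pos_right
      (atomProduct (X ω) f) hε)
    have hFlim : Tendsto (fun r => ∏ p ∈ F, gridCeil r (f p)) atTop (𝓝 (∏ p ∈ F, f p)) :=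
      tendsto_finsetProd _ fun p _ => tendsto_gridCeil (h0 p)
    obtain ⟨N, hN⟩ := eventually_atTop.mp (hFlim.eventually (gt_mem_nhds hF))
    refine ⟨N, fun r hr => ?_⟩
    have hlow : atomProduct (X ω) f ≤ atomProduct (X ω) (fun p => gridCeil r (f p)) :=
      atomProduct_mono h0 (fun p => le_gridCeil r _) fun p => gridCeil_le_one r (h1 p)
    have hup : atomProduct (X ω) (fun p => gridCeil r (f p)) ≤ _ :=
      atomProduct_le_prod (fun p => gridCeil_nonneg r _) (fun p => gridCeil_le_one r (h1 p)) F
    rw [Real.dist_eq, abs_of_nonneg (by linarith)]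
    linarith [hN r hr]
  -- pass to the limit `r → ∞` on both sides of the identity for finitely many counts
  refine ⟨aemeasurable_of_tendsto_metrizable_ae atTop (fun r => (hYm r).aemeasurable) hlim, ?_⟩
  have hE : Tendsto (fun r => ∫ ω, Y r ω ∂P) atTop (𝓝 (∫ ω, atomProduct (X ω) f ∂P)) :=
    tendsto_integral_of_dominated_convergence (fun _ => 1)
      (fun r => (hYm r).aestronglyMeasurable) (integrable_const 1)
      (fun r => Eventually.of_forall fun ω => by
        rw [Real.norm_of_nonneg (hY0 r ω)]; exact hY1 r ω) hlim
  have hgm : ∀ r, Measurable fun p => 1 - gridCeil r (f p) := fun r =>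
    measurable_const.sub (((measurable_from_top (f := fun k : ℕ => (k : ℝ))).comp
      (Nat.measurable_ceil.comp (hf.const_mul _))).div_const _)
  have hI : Tendsto (fun r => ∫ p, (1 - gridCeil r (f p)) ∂μ) atTop (𝓝 (∫ p, (1 - f p) ∂μ)) :=
    tendsto_integral_of_dominated_convergence (fun p => 1 - f p)
      (fun r => (hgm r).aestronglyMeasurable) hint
      (fun r => Eventually.of_forall fun p => by
        rw [Real.norm_of_nonneg (by linarith [gridCeil_le_one r (h1 p)])]
        linarith [le_gridCeil r (f p)])
      (Eventually.of_forall fun p => tendsto_const_nhds.sub (tendsto_gridCeil (h0 p)))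
  refine tendsto_nhds_unique hE ?_
  have hval : ∀ r, ∫ ω, Y r ω ∂P = Real.exp (-∫ p, (1 - gridCeil r (f p)) ∂μ) := by
    intro r
    have hl := measurableSet_gridLevel hf r
    have ht := measure_gridLevel_ne_top h1 hint r
    rw [hY, hX.integral_prod_pow_count (A := fun i : Fin (r + 1) => gridLevel f r i)
      (fun i => hl i) (fun i j hij => disjoint_gridLevel f r (Fin.val_injective.ne hij)) ht]
    simp_rw [one_sub_gridCeil_eq_sum h1 r]
    rw [integral_finsetSum _ fun (i : Fin (r + 1)) _ => (integrable_indicator_iff (hl i)).mpr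
      (integrableOn_const (ht i))]
    congr 2
    refine Finset.sum_congr rfl fun i _ => ?_
    rw [integral_indicator_const _ (hl i), smul_eq_mul]
    rfl
  simp_rw [hval]
  exact (Real.continuous_exp.tendsto _).comp hI.neg

end Laplace

/-! ### Moments of the measure `z⁻¹ (1-z)^(θ-1) dz` -/

section BreakMeasure

variable {θ : ℝ}

instance (θ : ℝ) : SFinite (breakMeasure θ) := by
  unfold breakMeasure; infer_instance

theorem ae_breakMeasure_mem_Ioo (θ : ℝ) : ∀ᵐ z ∂(breakMeasure θ), z ∈ Ioo (0 : ℝ) 1 :=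
  (withDensity_absolutelyContinuous _ _).ae_le (ae_restrict_mem measurableSet_Ioo)

theorem measurable_breakDensity (θ : ℝ) :
    Measurable fun z : ℝ => ENNReal.ofReal (z⁻¹ * (1 - z) ^ (θ - 1)) := by fun_prop

theorem breakDensity_nonneg (θ : ℝ) {z : ℝ} (hz : z ∈ Ioo (0 : ℝ) 1) :
    0 ≤ z⁻¹ * (1 - z) ^ (θ - 1) :=
  mul_nonneg (inv_nonneg.mpr hz.1.le) (Real.rpow_nonneg (by linarith [hz.2]) _)

theorem integrable_breakMeasure_iff (f : ℝ → ℝ) :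
    Integrable f (breakMeasure θ) ↔
      IntegrableOn (fun z => z⁻¹ * (1 - z) ^ (θ - 1) * f z) (Ioo 0 1) := by
  unfold breakMeasure
  rw [integrable_withDensity_iff_integrable_smul' (measurable_breakDensity θ)
    (Eventually.of_forall fun _ => ENNReal.ofReal_lt_top)]
  refine integrable_congr ?_
  filter_upwards [ae_restrict_mem measurableSet_Ioo] with z hz
  rw [ENNReal.toReal_ofReal (breakDensity_nonneg θ hz), smul_eq_mul]

theorem integral_breakMeasure (f : ℝ → ℝ) :
    ∫ z, f z ∂(breakMeasure θ) = ∫ z in Ioo 0 1, z⁻¹ * (1 - z) ^ (θ - 1) * f z := by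
  unfold breakMeasure
  rw [integral_withDensity_eq_integral_toReal_smul (measurable_breakDensity θ)
    (Eventually.of_forall fun _ => ENNReal.ofReal_lt_top)]
  refine integral_congr_ae ?_
  filter_upwards [ae_restrict_mem measurableSet_Ioo] with z hz
  rw [ENNReal.toReal_ofReal (breakDensity_nonneg θ hz), smul_eq_mul]

theorem breakDensity_mul_pow (θ : ℝ) (b : ℕ) {z : ℝ} (hz : z ∈ Ioo (0 : ℝ) 1) :
    z⁻¹ * (1 - z) ^ (θ - 1) * (z * (1 - z) ^ b) = (1 - z) ^ (b + θ - 1) := by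
  have h1 : 0 < 1 - z := by linarith [hz.2]
  have h2 : (1 - z) ^ ((b : ℝ) + θ - 1) = (1 - z) ^ b * (1 - z) ^ (θ - 1) := by
    rw [← Real.rpow_natCast, ← Real.rpow_add h1]; congr 1; ring
  rw [h2]
  field_simp [hz.1.ne']

theorem intervalIntegrable_one_sub_rpow {s : ℝ} (hs : 0 < s) :
    IntervalIntegrable (fun z : ℝ => (1 - z) ^ (s - 1)) volume 0 1 := by
  have h := (intervalIntegral.intervalIntegrable_rpow' (a := 0) (b := 1)
    (show -1 < s - 1 by linarith)).comp_sub_left 1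
  simpa using h.symm

theorem integral_mul_one_sub_pow (hθ : 0 < θ) (b : ℕ) :
    Integrable (fun z => z * (1 - z) ^ b) (breakMeasure θ) ∧
      ∫ z, z * (1 - z) ^ b ∂(breakMeasure θ) = 1 / (θ + b) := by
  have hs : 0 < (b : ℝ) + θ := by positivity
  constructor
  · rw [integrable_breakMeasure_iff]
    have h := (intervalIntegrable_iff_integrableOn_Ioo_of_le zero_le_one).mp
      (intervalIntegrable_one_sub_rpow hs)
    exact h.congr_fun (fun z hz => (breakDensity_mul_pow θ b hz).symm) measurableSet_Ioo
  · rw [integral_breakMeasure, setIntegral_congr_fun measurableSet_Ioo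
      (fun z hz => breakDensity_mul_pow θ b hz), ← integral_Ioc_eq_integral_Ioo,
      ← intervalIntegral.integral_of_le zero_le_one,
      intervalIntegral.integral_comp_sub_left (fun x => x ^ ((b : ℝ) + θ - 1)) 1,
      integral_rpow (Or.inl (by linarith))]
    rw [sub_self, sub_zero, sub_add_cancel, Real.zero_rpow hs.ne', Real.one_rpow, sub_zero,
      add_comm]

theorem ascPochhammer_eval_add_one (θ : ℝ) (n : ℕ) :
    (ascPochhammer ℝ (n + 1)).eval θ = (ascPochhammer ℝ n).eval θ * (θ + n) := by
  simp [ascPochhammer_succ_right]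

/-- The beta integral `∫ z^(a+1) (1-z)^b dω = a! [θ]_b / [θ]_(a+b+1)`, from the case `a = 0` by
`z^(a+1) (1-z)^b = z^a (1-z)^b - z^a (1-z)^(b+1)`. -/
theorem integral_pow_mul_one_sub_pow (hθ : 0 < θ) (a b : ℕ) :
    Integrable (fun z => z ^ (a + 1) * (1 - z) ^ b) (breakMeasure θ) ∧
      ∫ z, z ^ (a + 1) * (1 - z) ^ b ∂(breakMeasure θ)
        = a.factorial * (ascPochhammer ℝ b).eval θ / (ascPochhammer ℝ (a + b + 1)).eval θ := by
  induction a generalizing b with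
  | zero =>
    obtain ⟨h1, h2⟩ := integral_mul_one_sub_pow hθ b
    have hb := ascPochhammer_pos b θ hθ
    have : 0 < θ + b := by positivity
    refine ⟨by simpa using h1, ?_⟩
    simp only [zero_add, pow_one, Nat.factorial_zero, Nat.cast_one, one_mul, h2,
      ascPochhammer_eval_add_one]
    field_simp
  | succ a ih =>
    obtain ⟨h1, h2⟩ := ih b
    obtain ⟨h3, h4⟩ := ih (b + 1)
    have hfun : (fun z : ℝ => z ^ (a + 1 + 1) * (1 - z) ^ b)
        = fun z => z ^ (a + 1) * (1 - z) ^ b - z ^ (a + 1) * (1 - z) ^ (b + 1) := by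
      funext z; ring
    rw [hfun]
    refine ⟨h1.sub h3, ?_⟩
    rw [integral_sub h1 h3, h2, h4]
    have e1 : a + (b + 1) + 1 = a + b + 1 + 1 := by ring
    have e2 : a + 1 + b + 1 = a + b + 1 + 1 := by ring
    have hp := ascPochhammer_pos (a + b + 1) θ hθ
    rw [e1, e2, ascPochhammer_eval_add_one θ (a + b + 1), ascPochhammer_eval_add_one θ b,
      Nat.factorial_succ]
    have : 0 < θ + (a + b + 1 : ℕ) := by positivity
    push_cast at this ⊢
    field_simp
    ring

theorem genHarmonic_zero (θ : ℝ) : genHarmonic θ 0 = 0 := by simp [genHarmonic]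

theorem genHarmonic_add_one (θ : ℝ) (n : ℕ) :
    genHarmonic θ (n + 1) = genHarmonic θ n + 1 / (θ + n) := by
  rw [genHarmonic, Finset.sum_Icc_succ_top (by omega), genHarmonic]
  congr 2
  push_cast; ring

theorem genHarmonic_nonneg (hθ : 0 < θ) (n : ℕ) : 0 ≤ genHarmonic θ n := by
  induction n with
  | zero => simp [genHarmonic_zero]
  | succ n ih => rw [genHarmonic_add_one]; positivity

theorem genHarmonic_pos (hθ : 0 < θ) {n : ℕ} (hn : 0 < n) : 0 < genHarmonic θ n := by
  obtain ⟨m, rfl⟩ := Nat.exists_eq_succ_of_ne_zero hn.ne'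
  have := genHarmonic_nonneg hθ m
  rw [Nat.succ_eq_add_one, genHarmonic_add_one]
  positivity

/-- The Laplace exponent of the subordinator at the integers is the generalised harmonic number:
`∫ (1 - (1-z)^n) dω = h_θ(n)`. -/
theorem integral_one_sub_one_sub_pow (hθ : 0 < θ) (n : ℕ) :
    Integrable (fun z => 1 - (1 - z) ^ n) (breakMeasure θ) ∧
      ∫ z, (1 - (1 - z) ^ n) ∂(breakMeasure θ) = genHarmonic θ n := by
  induction n with
  | zero => simp [genHarmonic_zero]
  | succ n ih =>
    obtain ⟨h1, h2⟩ := ih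
    obtain ⟨h3, h4⟩ := integral_mul_one_sub_pow hθ n
    have hfun : (fun z : ℝ => 1 - (1 - z) ^ (n + 1))
        = fun z => (1 - (1 - z) ^ n) + z * (1 - z) ^ n := by funext z; ring
    rw [hfun]
    exact ⟨h1.add h3, by rw [integral_add h1 h3, h2, h4, genHarmonic_add_one]⟩

theorem integral_polynomial_sub (hθ : 0 < θ) (p : Polynomial ℝ) :
    ∫ z, (p.eval (1 - z) - p.eval 1) ∂(breakMeasure θ)
      = -∑ k ∈ Finset.range (p.natDegree + 1), p.coeff k * genHarmonic θ k := by
  have hfun : (fun z : ℝ => p.eval (1 - z) - p.eval 1)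
      = fun z => ∑ k ∈ Finset.range (p.natDegree + 1), -(p.coeff k) * (1 - (1 - z) ^ k) := by
    funext z
    rw [Polynomial.eval_eq_sum_range, Polynomial.eval_eq_sum_range, ← Finset.sum_sub_distrib]
    refine Finset.sum_congr rfl fun k _ => ?_
    rw [one_pow]; ring
  rw [hfun, integral_finsetSum _ fun k _ => (integral_one_sub_one_sub_pow hθ k).1.const_mul _,
    ← Finset.sum_neg_distrib]
  refine Finset.sum_congr rfl fun k _ => ?_
  rw [integral_const_mul, (integral_one_sub_one_sub_pow hθ k).2]; ring

theorem binomialMoment_breakMeasure (hθ : 0 < θ) {n m : ℕ} (hm : 0 < m) (hmn : m ≤ n) :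
    binomialMoment (breakMeasure θ) n m
      = n.factorial / (m * (n - m).factorial) *
        ((ascPochhammer ℝ (n - m)).eval θ / (ascPochhammer ℝ n).eval θ) := by
  obtain ⟨a, rfl⟩ := Nat.exists_eq_succ_of_ne_zero hm.ne'
  obtain ⟨b, rfl⟩ := Nat.exists_eq_add_of_le hmn
  have e1 : a.succ + b - a.succ = b := by omega
  have e2 : a + b + 1 = a.succ + b := by omega
  rw [binomialMoment, e1, Nat.succ_eq_add_one, (integral_pow_mul_one_sub_pow hθ a b).2, e2,
    Nat.cast_add_choose, Nat.factorial_succ a]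
  have h1 := ascPochhammer_pos (a.succ + b) θ hθ
  have h2 : ((b.factorial : ℕ) : ℝ) ≠ 0 := by exact_mod_cast b.factorial_ne_zero
  have h3 : ((a.factorial : ℕ) : ℝ) ≠ 0 := by exact_mod_cast a.factorial_ne_zero
  push_cast
  field_simp

theorem sum_binomialMoment_breakMeasure (hθ : 0 < θ) (n : ℕ) :
    ∑ k ∈ Finset.Icc 1 n, binomialMoment (breakMeasure θ) n k = genHarmonic θ n := by
  rw [← (integral_one_sub_one_sub_pow hθ n).2]
  have hfun : (fun z : ℝ => 1 - (1 - z) ^ n)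
      = fun z => ∑ k ∈ Finset.Icc 1 n, (n.choose k : ℝ) * (z ^ k * (1 - z) ^ (n - k)) := by
    funext z
    have h := add_pow z (1 - z) n
    rw [add_sub_cancel, one_pow, Finset.range_eq_Ico,
      Finset.sum_eq_sum_Ico_succ_bot (by omega)] at h
    have hI : Finset.Ico (0 + 1) (n + 1) = Finset.Icc 1 n := by ext; simp
    rw [hI] at h
    simp only [pow_zero, one_mul, Nat.sub_zero, Nat.choose_zero_right, Nat.cast_one,
      mul_one] at h
    rw [eq_comm, ← eq_sub_iff_add_eq'] at h
    rw [← h]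
    exact Finset.sum_congr rfl fun k _ => by ring
  rw [hfun, integral_finsetSum]
  · exact Finset.sum_congr rfl fun k _ => by rw [binomialMoment, integral_const_mul]
  · intro k hk
    obtain ⟨a, rfl⟩ := Nat.exists_eq_succ_of_ne_zero (show k ≠ 0 by
      have := (Finset.mem_Icc.mp hk).1; omega)
    exact (integral_pow_mul_one_sub_pow hθ a _).1.const_mul _

end BreakMeasure

/-! ### The product form -/

section ProductForm

variable {θ : ℝ}

theorem sum_Ici_get_eq_sum_drop (l : List ℕ) (j : Fin l.length) :
    ∑ i ∈ Finset.Ici j, l.get i = (l.drop j).sum := by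
  have h : Finset.Ici j = Finset.univ.filter (fun i => j ≤ i) := by ext; simp
  rw [h, Finset.sum_filter]
  clear h
  induction l with
  | nil => exact j.elim0
  | cons a l ih =>
    refine (Fin.sum_univ_succ (n := l.length) _).trans ?_
    refine Fin.cases ?_ (fun k => ?_) j
    · simp [← List.sum_ofFn]
    · have := ih k
      simpa using this

theorem tailSum_eq_sum_drop {n : ℕ} (c : Composition n) (j : Fin c.length) :
    tailSum c j = (c.blocks.drop j).sum :=
  sum_Ici_get_eq_sum_drop c.blocks j

/-- The product of `F λ_j Λ_j` over the parts `λ_j` and tail sums `Λ_j` of a composition, by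
recursion on the list of parts. -/
def blockProd (F : ℕ → ℕ → ℝ) : List ℕ → ℝ
  | [] => 1
  | a :: l => F a (a + l.sum) * blockProd F l

theorem prod_get_sum_drop (F : ℕ → ℕ → ℝ) (l : List ℕ) :
    ∏ j : Fin l.length, F (l.get j) (l.drop j).sum = blockProd F l := by
  induction l with
  | nil => simp [blockProd]
  | cons a l ih =>
    refine (Fin.prod_univ_succ (n := l.length) _).trans ?_
    rw [blockProd, ← ih]
    simp

theorem prod_blocksFun_tailSum {n : ℕ} (c : Composition n) (F : ℕ → ℕ → ℝ) :
    ∏ j : Fin c.length, F (c.blocksFun j) (tailSum c j) = blockProd F c.blocks := by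
  simp_rw [tailSum_eq_sum_drop]
  exact prod_get_sum_drop F c.blocks

/-- The weight `∏ 1 / (λ_j h_θ(Λ_j))` of a list of parts. -/
def harmonicWeight (θ : ℝ) (l : List ℕ) : ℝ :=
  blockProd (fun a s => 1 / ((a : ℝ) * genHarmonic θ s)) l

theorem harmonicWeight_cons (θ : ℝ) (a : ℕ) (l : List ℕ) :
    harmonicWeight θ (a :: l)
      = 1 / ((a : ℝ) * genHarmonic θ (a + l.sum)) * harmonicWeight θ l := rfl

theorem gFormula_eq (θ : ℝ) {n : ℕ} (c : Composition n) :
    gFormula θ n c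
      = (n.factorial : ℝ) / (ascPochhammer ℝ n).eval θ * harmonicWeight θ c.blocks := by
  rw [gFormula, prod_blocksFun_tailSum c fun a s => 1 / ((a : ℝ) * genHarmonic θ s)]
  rfl

theorem gFormula_nonneg (hθ : 0 < θ) (n : ℕ) (c : Composition n) : 0 ≤ gFormula θ n c := by
  refine mul_nonneg (div_nonneg (Nat.cast_nonneg _) (ascPochhammer_pos n θ hθ).le)
    (Finset.prod_nonneg fun j _ => ?_)
  have := genHarmonic_nonneg hθ (tailSum c j)
  positivity

theorem blockProd_decrement (hθ : 0 < θ) (l : List ℕ) (hl : ∀ a ∈ l, 0 < a) :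
    blockProd (fun a s => decrement (breakMeasure θ) s a) l
      = (l.sum.factorial : ℝ) / (ascPochhammer ℝ l.sum).eval θ * harmonicWeight θ l := by
  induction l with
  | nil => simp [blockProd, harmonicWeight]
  | cons a l ih =>
    have ha : 0 < a := hl a (by simp)
    rw [blockProd, ih fun b hb => hl b (by simp [hb]), harmonicWeight_cons, decrement,
      sum_binomialMoment_breakMeasure hθ, binomialMoment_breakMeasure hθ ha (by omega),
      Nat.add_sub_cancel_left, List.sum_cons]
    have h1 := ascPochhammer_pos (a + l.sum) θ hθ
    have h2 := ascPochhammer_pos l.sum θ hθ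
    have h3 := genHarmonic_pos hθ (show 0 < a + l.sum by omega)
    have h4 : (l.sum.factorial : ℝ) ≠ 0 := by exact_mod_cast l.sum.factorial_ne_zero
    have h5 : (a : ℝ) ≠ 0 := by exact_mod_cast ha.ne'
    field_simp

theorem gFormula_eq_prod_decrement (hθ : 0 < θ) (n : ℕ) (c : Composition n) :
    gFormula θ n c
      = ∏ j : Fin c.length, decrement (breakMeasure θ) (tailSum c j) (c.blocksFun j) := by
  rw [prod_blocksFun_tailSum c fun a s => decrement (breakMeasure θ) s a,
    blockProd_decrement hθ _ fun a ha => c.blocks_pos ha, c.blocks_sum, gFormula_eq]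

end ProductForm

/-! ### Consistency under removal of a random ball -/

section Consistency

variable {θ : ℝ}

theorem removeBall_zero {x : ℕ} {d : List ℕ} (hx : 0 < x) (hd : ∀ y ∈ d, 0 < y) :
    removeBall (x :: d) 0 = if x = 1 then d else (x - 1) :: d := by
  have hf : d.filter (fun a => a ≠ 0) = d :=
    List.filter_eq_self.mpr fun y hy => by simpa using (hd y hy).ne'
  unfold removeBall
  rw [List.modify_zero_cons, List.filter_cons, hf]
  split_ifs with h1 h2 h2 <;> simp at * <;> omega

theorem removeBall_succ {x : ℕ} (d : List ℕ) (hx : 0 < x) (j : ℕ) :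
    removeBall (x :: d) (j + 1) = x :: removeBall d j := by
  unfold removeBall
  rw [List.modify_succ_cons, List.filter_cons, if_pos (by simpa using hx.ne')]

theorem removeBall_pos (d : List ℕ) (j : ℕ) : ∀ y ∈ removeBall d j, 0 < y := by
  intro y hy
  have := (List.mem_filter.mp hy).2
  simp at this
  omega

theorem sum_removeBall {d : List ℕ} (hd : ∀ y ∈ d, 0 < y) {j : ℕ} (hj : j < d.length) :
    (removeBall d j).sum + 1 = d.sum := by
  induction d generalizing j with
  | nil => simp at hj
  | cons x d ih =>
    have hx : 0 < x := hd x (by simp)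
    have hd' : ∀ y ∈ d, 0 < y := fun y hy => hd y (by simp [hy])
    cases j with
    | zero =>
      rw [removeBall_zero hx hd']
      split_ifs with h
      · simp [h]; omega
      · simp; omega
    | succ j =>
      rw [removeBall_succ d hx, List.sum_cons, List.sum_cons, add_assoc,
        ih hd' (by simpa using hj)]

/-- Putting a box in front of a list of boxes with a marked position. -/
def consSucc (a : ℕ) : List ℕ × ℕ ↪ List ℕ × ℕ where
  toFun x := (a :: x.1, x.2 + 1)
  inj' x y h := by
    simp only [Prod.mk.injEq, List.cons.injEq, true_and, add_left_inj] at h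
    exact Prod.ext h.1 h.2

theorem consSucc_apply (a : ℕ) (x : List ℕ × ℕ) : consSucc a x = (a :: x.1, x.2 + 1) := rfl

/-- The pairs `(d, j)` such that removing a ball from the `j`-th box of `d` gives `l`: either a
ball of the `j`-th box of `l` is put back, or a box with a single ball is inserted. -/
def addBall : List ℕ → Finset (List ℕ × ℕ)
  | [] => {([1], 0)}
  | a :: l => insert ((a + 1) :: l, 0) (insert (1 :: a :: l, 0)
      ((addBall l).map (consSucc a)))

theorem mem_addBall {l : List ℕ} (hl : ∀ y ∈ l, 0 < y) (d : List ℕ) (j : ℕ) :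
    (d, j) ∈ addBall l ↔ (∀ y ∈ d, 0 < y) ∧ j < d.length ∧ removeBall d j = l := by
  induction l generalizing d j with
  | nil =>
    simp only [addBall, Finset.mem_singleton, Prod.mk.injEq]
    constructor
    · rintro ⟨rfl, rfl⟩
      simp [removeBall]
    · rintro ⟨h1, h2, h3⟩
      cases d with
      | nil => simp at h2
      | cons x d =>
        have hx : 0 < x := h1 x (by simp)
        cases j with
        | zero =>
          rw [removeBall_zero hx fun y hy => h1 y (by simp [hy])] at h3
          split_ifs at h3 with h
          simp [h, h3]
        | succ j => simp [removeBall_succ d hx] at h3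
  | cons a l ih =>
    have ha : 0 < a := hl a (by simp)
    have hl' : ∀ y ∈ l, 0 < y := fun y hy => hl y (by simp [hy])
    simp only [addBall, Finset.mem_insert, Finset.mem_map, consSucc_apply,
      Prod.mk.injEq, Prod.exists]
    constructor
    · rintro (⟨rfl, rfl⟩ | ⟨rfl, rfl⟩ | ⟨d', j', hd', rfl, rfl⟩)
      · refine ⟨by simpa using hl', by simp, ?_⟩
        rw [removeBall_zero (by omega) hl', if_neg (by omega)]; rfl
      · refine ⟨by simpa using ⟨ha, hl'⟩, by simp, ?_⟩
        rw [removeBall_zero (by omega) hl, if_pos rfl]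
      · obtain ⟨h1, h2, h3⟩ := (ih hl' d' j').mp hd'
        exact ⟨by simpa using ⟨ha, h1⟩, by simpa using h2, by rw [removeBall_succ d' ha, h3]⟩
    · rintro ⟨h1, h2, h3⟩
      cases d with
      | nil => simp at h2
      | cons x d =>
        have hx : 0 < x := h1 x (by simp)
        have hd : ∀ y ∈ d, 0 < y := fun y hy => h1 y (by simp [hy])
        cases j with
        | zero =>
          rw [removeBall_zero hx hd] at h3
          split_ifs at h3 with h
          · right; left; simp [h, h3]
          · left
            simp only [List.cons.injEq] at h3
            refine ⟨?_, rfl⟩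
            rw [h3.2, ← h3.1]; congr 1; omega
        | succ j =>
          rw [removeBall_succ d hx, List.cons.injEq] at h3
          right; right
          exact ⟨d, j, (ih hl' d j).mpr ⟨hd, by simpa using h2, h3.2⟩, by rw [h3.1], rfl⟩

theorem sum_addBall_harmonicWeight (hθ : 0 < θ) {l : List ℕ} (hl : ∀ y ∈ l, 0 < y) :
    ∑ x ∈ addBall l, harmonicWeight θ x.1 * (x.1.getD x.2 0 : ℕ)
      = (θ + l.sum) * harmonicWeight θ l := by
  induction l with
  | nil =>
    simp [addBall, harmonicWeight, blockProd, genHarmonic]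
  | cons a l ih =>
    have ha : 0 < a := hl a (by simp)
    have hl' : ∀ y ∈ l, 0 < y := fun y hy => hl y (by simp [hy])
    have hne : (a + 1) :: l ≠ 1 :: a :: l := by
      intro h
      have := congrArg List.length h
      simp at this
    rw [addBall, Finset.sum_insert, Finset.sum_insert, Finset.sum_map]
    rotate_left
    · simp [consSucc_apply]
    · simp [hne, consSucc_apply]
    -- a ball put back behind the first box raises the tail sum of that box by one
    have h : ∀ x ∈ addBall l, harmonicWeight θ (a :: x.1) * ((a :: x.1).getD (x.2 + 1) 0 : ℕ)
        = 1 / ((a : ℝ) * genHarmonic θ (a + l.sum + 1))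
          * (harmonicWeight θ x.1 * (x.1.getD x.2 0 : ℕ)) := by
      rintro ⟨d, j⟩ hx
      obtain ⟨h1, h2, h3⟩ := (mem_addBall hl' d j).mp hx
      have hs := sum_removeBall h1 h2
      rw [h3] at hs
      rw [harmonicWeight_cons, List.getD_cons_succ, ← hs, ← add_assoc]
      ring
    simp only [consSucc_apply]
    rw [Finset.sum_congr rfl h, ← Finset.mul_sum, ih hl']
    simp only [harmonicWeight_cons, List.getD_cons_zero, List.sum_cons]
    have e1 : a + 1 + l.sum = a + l.sum + 1 := by ring
    have e2 : 1 + (a + l.sum) = a + l.sum + 1 := by ring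
    have hH := genHarmonic_pos hθ (show 0 < a + l.sum by omega)
    have ha' : (0 : ℝ) < a := by exact_mod_cast ha
    have hs : (0 : ℝ) ≤ l.sum := Nat.cast_nonneg _
    rw [e1, e2, genHarmonic_add_one]
    generalize genHarmonic θ (a + l.sum) = H at hH ⊢
    generalize l.sum = s at hs ⊢
    push_cast
    have h1 : 0 < θ + ((a : ℝ) + s) := by positivity
    have h2 : 0 < H * (θ + ((a : ℝ) + s)) + 1 := by positivity
    field_simp
    ring

theorem gFormula_consistent (hθ : 0 < θ) (n : ℕ) (c : Composition n) :
    gFormula θ n c = ∑ d : Composition (n + 1), ∑ j : Fin d.length,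
      if removeBall d.blocks j = c.blocks
        then gFormula θ (n + 1) d * ((d.blocksFun j : ℝ) / (n + 1)) else 0 := by
  have hc : ∀ y ∈ c.blocks, 0 < y := fun y hy => c.blocks_pos hy
  have hkey := sum_addBall_harmonicWeight hθ hc
  rw [c.blocks_sum] at hkey
  have hsum : ∑ d : Composition (n + 1), ∑ j : Fin d.length,
      (if removeBall d.blocks j = c.blocks
        then gFormula θ (n + 1) d * ((d.blocksFun j : ℝ) / (n + 1)) else 0)
      = ∑ x ∈ addBall c.blocks, (n.factorial : ℝ) / (ascPochhammer ℝ (n + 1)).eval θ *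
          (harmonicWeight θ x.1 * (x.1.getD x.2 0 : ℕ)) := by
    rw [Finset.sum_sigma', Finset.univ_sigma_univ, ← Finset.sum_filter]
    refine Finset.sum_bij (fun x _ => (x.1.blocks, (x.2 : ℕ))) ?_ ?_ ?_ ?_
    · rintro ⟨d, j⟩ hx
      exact (mem_addBall hc _ _).mpr ⟨fun y hy => d.blocks_pos hy, j.2,
        (Finset.mem_filter.mp hx).2⟩
    · rintro ⟨d, j⟩ _ ⟨d', j'⟩ _ h
      obtain ⟨h1, h2⟩ := Prod.mk.inj h
      obtain rfl : d = d' := Composition.ext h1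
      obtain rfl : j = j' := Fin.ext h2
      rfl
    · rintro ⟨d, j⟩ hx
      obtain ⟨h1, h2, h3⟩ := (mem_addBall hc d j).mp hx
      have hs := sum_removeBall h1 h2
      rw [h3, c.blocks_sum] at hs
      exact ⟨⟨⟨d, fun {y} hy => h1 y hy, hs.symm⟩, ⟨j, h2⟩⟩,
        Finset.mem_filter.mpr ⟨Finset.mem_univ _, h3⟩, rfl⟩
    · rintro ⟨d, j⟩ _
      have hj : d.blocks.getD j 0 = d.blocksFun j := by
        rw [List.getD_eq_getElem _ _ j.2]; rfl
      simp only
      rw [hj, gFormula_eq, Nat.factorial_succ]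
      push_cast
      have : (0 : ℝ) < n + 1 := by positivity
      field_simp
  rw [hsum, ← Finset.mul_sum, hkey, gFormula_eq, ascPochhammer_eval_add_one]
  have h1 := ascPochhammer_pos n θ hθ
  have : 0 < θ + n := by positivity
  field_simp

theorem sum_gFormula (hθ : 0 < θ) (n : ℕ) : ∑ c : Composition n, gFormula θ n c = 1 := by
  induction n with
  | zero =>
    have : ∀ c : Composition 0, gFormula θ 0 c = 1 := fun c => by
      have hb : c.blocks = [] := c.blocks_eq_nil.mpr rfl
      rw [gFormula_eq, hb]
      simp [harmonicWeight, blockProd]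
    simp [this, composition_card]
  | succ n ih =>
    rw [← ih, Finset.sum_congr rfl fun c _ => gFormula_consistent hθ n c, Finset.sum_comm]
    refine Finset.sum_congr rfl fun d _ => ?_
    rw [Finset.sum_comm]
    have h : ∀ j : Fin d.length, (∑ c : Composition n, if removeBall d.blocks j = c.blocks
        then gFormula θ (n + 1) d * ((d.blocksFun j : ℝ) / (n + 1)) else 0)
        = gFormula θ (n + 1) d * ((d.blocksFun j : ℝ) / (n + 1)) := by
      intro j
      have hs := sum_removeBall (fun y hy => d.blocks_pos hy) j.2
      rw [d.blocks_sum, add_left_inj] at hs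
      rw [Finset.sum_eq_single ⟨removeBall d.blocks j, fun {y} hy => removeBall_pos _ _ y hy, hs⟩]
      · simp
      · intro c _ hne
        rw [if_neg]
        intro h
        exact hne (Composition.ext h.symm)
      · simp
    rw [Finset.sum_congr rfl fun j _ => h j, ← Finset.mul_sum, ← Finset.sum_div]
    have hsum : (∑ j : Fin d.length, (d.blocksFun j : ℝ)) = n + 1 := by
      exact_mod_cast d.sum_blocksFun
    rw [hsum, div_self (by positivity), mul_one]

theorem isCompositionStructure_gFormula (hθ : 0 < θ) : IsCompositionStructure (gFormula θ) where
  nonneg := gFormula_nonneg hθ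
  sum_eq_one := sum_gFormula hθ
  consistent := gFormula_consistent hθ

end Consistency

/-! ### Survival factors of the strip process -/

section Survival

/-- The factor `1 - ξ` of an atom with mark `ξ ∈ [0,1]`; marks outside `[0,1]`, which almost surely
do not occur, get the factor `1`, so that the factor always lies in `[0,1]`. -/
def stay (z : ℝ) : ℝ := (Icc (0 : ℝ) 1).indicator (fun z => 1 - z) z + (Icc (0 : ℝ) 1)ᶜ.indicator 1 z

theorem stay_of_mem {z : ℝ} (hz : z ∈ Icc (0 : ℝ) 1) : stay z = 1 - z := by
  simp [stay, hz]

theorem stay_of_notMem {z : ℝ} (hz : z ∉ Icc (0 : ℝ) 1) : stay z = 1 := by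
  rw [stay, indicator_of_notMem hz, indicator_of_mem (mem_compl hz)]; simp

theorem stay_nonneg (z : ℝ) : 0 ≤ stay z := by
  by_cases hz : z ∈ Icc (0 : ℝ) 1
  · rw [stay_of_mem hz]; linarith [hz.2]
  · rw [stay_of_notMem hz]; exact zero_le_one

theorem stay_le_one (z : ℝ) : stay z ≤ 1 := by
  by_cases hz : z ∈ Icc (0 : ℝ) 1
  · rw [stay_of_mem hz]; linarith [hz.1]
  · rw [stay_of_notMem hz]

theorem measurable_stay : Measurable stay :=
  ((measurable_const.sub measurable_id).indicator measurableSet_Icc).add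
    (measurable_one.indicator measurableSet_Icc.compl)

open Classical in
/-- The function of an atom `(τ, ξ)` that is `ψ ξ` if `τ ∈ J` and `1` otherwise. -/
def timeFactor (J : Set ℝ) (ψ : ℝ → ℝ) (p : ℝ × ℝ) : ℝ := if p.1 ∈ J then ψ p.2 else 1

theorem timeFactor_of_mem {J : Set ℝ} {p : ℝ × ℝ} (h : p.1 ∈ J) (ψ : ℝ → ℝ) :
    timeFactor J ψ p = ψ p.2 := if_pos h

theorem timeFactor_of_notMem {J : Set ℝ} {p : ℝ × ℝ} (h : p.1 ∉ J) (ψ : ℝ → ℝ) :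
    timeFactor J ψ p = 1 := if_neg h

theorem timeFactor_nonneg (J : Set ℝ) {ψ : ℝ → ℝ} (h : ∀ z, 0 ≤ ψ z) (p : ℝ × ℝ) :
    0 ≤ timeFactor J ψ p := by
  unfold timeFactor; split_ifs
  exacts [h _, zero_le_one]

theorem timeFactor_le_one (J : Set ℝ) {ψ : ℝ → ℝ} (h : ∀ z, ψ z ≤ 1) (p : ℝ × ℝ) :
    timeFactor J ψ p ≤ 1 := by
  unfold timeFactor; split_ifs
  exacts [h _, le_rfl]

theorem measurable_timeFactor {J : Set ℝ} (hJ : MeasurableSet J) {ψ : ℝ → ℝ} (h : Measurable ψ) :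
    Measurable (timeFactor J ψ) :=
  Measurable.ite (measurable_fst hJ) (h.comp measurable_snd) measurable_const

theorem one_sub_timeFactor (J : Set ℝ) (ψ : ℝ → ℝ) (p : ℝ × ℝ) :
    1 - timeFactor J ψ p = J.indicator 1 p.1 * (1 - ψ p.2) := by
  by_cases h : p.1 ∈ J <;> simp [timeFactor, h]

/-- The fraction of the unit interval that survives the atoms with time in `J`: the product of the
factors `1 - ξ` over these atoms. -/
def survival (X : Set (ℝ × ℝ)) (J : Set ℝ) : ℝ := atomProduct X (timeFactor J stay)

variable {X : Set (ℝ × ℝ)}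

theorem survival_nonneg (X : Set (ℝ × ℝ)) (J : Set ℝ) : 0 ≤ survival X J :=
  atomProduct_nonneg (timeFactor_nonneg J stay_nonneg) (timeFactor_le_one J stay_le_one)

theorem survival_le_one (X : Set (ℝ × ℝ)) (J : Set ℝ) : survival X J ≤ 1 :=
  atomProduct_le_one (timeFactor_nonneg J stay_nonneg) (timeFactor_le_one J stay_le_one)

theorem survival_union (X : Set (ℝ × ℝ)) {J K : Set ℝ} (h : Disjoint J K) :
    survival X (J ∪ K) = survival X J * survival X K := by
  have hf : timeFactor (J ∪ K) stay = fun p => timeFactor J stay p * timeFactor K stay p := by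
    funext p
    by_cases hJ : p.1 ∈ J
    · rw [timeFactor_of_mem (Or.inl hJ), timeFactor_of_mem hJ,
        timeFactor_of_notMem (Set.disjoint_left.mp h hJ), mul_one]
    · by_cases hK : p.1 ∈ K
      · rw [timeFactor_of_mem (Or.inr hK), timeFactor_of_mem hK, timeFactor_of_notMem hJ, one_mul]
      · rw [timeFactor_of_notMem (by simp [hJ, hK]), timeFactor_of_notMem hJ,
          timeFactor_of_notMem hK, one_mul]
  rw [survival, hf, atomProduct_mul (timeFactor_nonneg J stay_nonneg)
    (timeFactor_le_one J stay_le_one) (timeFactor_nonneg K stay_nonneg)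
    (timeFactor_le_one K stay_le_one)]
  rfl

theorem survival_Iic_mul_Ioc (X : Set (ℝ × ℝ)) {s t : ℝ} (h : s ≤ t) :
    survival X (Iic t) = survival X (Iic s) * survival X (Ioc s t) := by
  have hd : Disjoint (Iic s) (Ioc s t) :=
    Set.disjoint_left.mpr fun _ hx hx' => (lt_irrefl _ (hx'.1.trans_le hx)).elim
  rw [← survival_union X hd, Iic_union_Ioc_eq_Iic h]

theorem antitone_survival_Iic (X : Set (ℝ × ℝ)) : Antitone fun t => survival X (Iic t) := by
  intro s t h
  change survival X (Iic t) ≤ survival X (Iic s)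
  rw [survival_Iic_mul_Ioc X h]
  exact mul_le_of_le_one_right (survival_nonneg _ _) (survival_le_one _ _)

/-- The properties of a realization of the Poisson process that hold almost surely and make the
path of the subordinator a right-continuous increasing function from `0` to `1`. -/
structure IsRegular (X : Set (ℝ × ℝ)) : Prop where
  subset : X ⊆ Ioi 0 ×ˢ Ioo 0 1
  pos : ∀ t, 0 < survival X (Iic t)
  exists_lt : ∀ ε > 0, ∃ t, survival X (Iic t) < ε

theorem subordinator_eq (hX : X ⊆ Ioi 0 ×ˢ Ioo 0 1) (t : ℝ) :
    subordinator X t = 1 - survival X (Iic t) := by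
  have h1 : ∏' p : {p : ℝ × ℝ // p ∈ X ∧ p.1 ≤ t}, (1 - p.1.2)
      = ∏' p, {p : ℝ × ℝ | p ∈ X ∧ p.1 ≤ t}.mulIndicator (fun p => 1 - p.2) p :=
    tprod_subtype {p : ℝ × ℝ | p ∈ X ∧ p.1 ≤ t} (fun p => 1 - p.2)
  have h2 : survival X (Iic t) = ∏' p, X.mulIndicator (timeFactor (Iic t) stay) p :=
    tprod_subtype X _
  rw [subordinator, h1, h2]
  congr 2
  funext p
  by_cases hp : p ∈ X
  · by_cases ht : p.1 ≤ t
    · rw [mulIndicator_of_mem (show p ∈ {p : ℝ × ℝ | p ∈ X ∧ p.1 ≤ t} from ⟨hp, ht⟩),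
        mulIndicator_of_mem hp, timeFactor_of_mem (by exact ht),
        stay_of_mem (Ioo_subset_Icc_self (hX hp).2)]
    · rw [mulIndicator_of_notMem (fun h => ht h.2),
        mulIndicator_of_mem hp, timeFactor_of_notMem (by exact ht)]
  · rw [mulIndicator_of_notMem (fun h => hp h.1), mulIndicator_of_notMem hp]

namespace IsRegular

theorem subordinator_eq (hX : IsRegular X) (t : ℝ) : subordinator X t = 1 - survival X (Iic t) :=
  SamplingFormula.subordinator_eq hX.subset t

theorem monotone (hX : IsRegular X) : Monotone (subordinator X) := fun s t h => by
  rw [hX.subordinator_eq, hX.subordinator_eq]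
  linarith [antitone_survival_Iic X h]

theorem mem_Ico (hX : IsRegular X) (t : ℝ) : subordinator X t ∈ Ico 0 1 := by
  rw [hX.subordinator_eq]
  exact ⟨by linarith [survival_le_one X (Iic t)], by linarith [hX.pos t]⟩

theorem subordinator_zero (hX : IsRegular X) : subordinator X 0 = 0 := by
  have h : survival X (Iic 0) = 1 := by
    have : ∀ p : X, timeFactor (Iic 0) stay p = 1 := fun p =>
      timeFactor_of_notMem (J := Iic 0) (notMem_Iic.mpr (hX.subset p.2).1) _
    rw [survival, atomProduct]
    simp [this]
  rw [hX.subordinator_eq, h, sub_self]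

/-- The path is right-continuous: a finite set of atoms accounts for all but a factor close to `1`
of the atoms up to time `t + 1`, and none of these finitely many atoms lies just after `t`. -/
theorem exists_lt_add (hX : IsRegular X) (t : ℝ) {ε : ℝ} (hε : 0 < ε) :
    ∃ δ > 0, ∀ s ∈ Icc t (t + δ), subordinator X s < subordinator X t + ε := by
  have hT := hX.pos (t + 1)
  obtain ⟨F, hF⟩ := exists_prod_lt_of_atomProduct_lt (S := X)
    (timeFactor_nonneg (Iic (t + 1)) stay_nonneg) (timeFactor_le_one (Iic (t + 1)) stay_le_one)
    (c := (1 + ε) * survival X (Iic (t + 1)))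
    (by change survival X (Iic (t + 1)) < _; nlinarith)
  -- no atom of `F` has its time in `(t, t + δ]`
  obtain ⟨δ, hδ0, hδ1, hδ⟩ : ∃ δ > 0, δ ≤ 1 ∧ ∀ p ∈ F, p.1.1 ∉ Ioc t (t + δ) := by
    have h : ∀ᶠ δ in 𝓝[>] (0 : ℝ), ∀ p ∈ F, p.1.1 ∉ Ioc t (t + δ) := by
      rw [eventually_all_finset]
      intro p _
      by_cases hp : t < p.1.1
      · have : ∀ᶠ δ in 𝓝[>] (0 : ℝ), δ < p.1.1 - t :=
          nhdsWithin_le_nhds (gt_mem_nhds (by linarith))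
        filter_upwards [this] with δ hδ hm
        linarith [hm.2]
      · exact Eventually.of_forall fun δ hm => hp hm.1
    have h1 : ∀ᶠ δ in 𝓝[>] (0 : ℝ), δ ≤ 1 :=
      nhdsWithin_le_nhds (ge_mem_nhds zero_lt_one)
    obtain ⟨δ, ha, hb, hc⟩ := (h.and (h1.and self_mem_nhdsWithin)).exists
    exact ⟨δ, hc, hb, ha⟩
  refine ⟨δ, hδ0, fun s hs => ?_⟩
  have hsplit : survival X (Iic (t + 1))
      = survival X (Iic (t + 1) \ Ioc t s) * survival X (Ioc t s) := by
    rw [← survival_union X disjoint_sdiff_left, sdiff_union_of_subset]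
    exact fun x hx => hx.2.trans (hs.2.trans (by linarith))
  have hle : survival X (Iic (t + 1) \ Ioc t s) ≤ (1 + ε) * survival X (Iic (t + 1)) := by
    refine (atomProduct_le_prod (timeFactor_nonneg _ stay_nonneg)
      (timeFactor_le_one _ stay_le_one) F).trans (le_of_eq_of_le ?_ hF.le)
    refine Finset.prod_congr rfl fun p hp => ?_
    have hn : p.1.1 ∉ Ioc t s := fun h => hδ p hp ⟨h.1, h.2.trans hs.2⟩
    by_cases hm : p.1.1 ∈ Iic (t + 1)
    · rw [timeFactor_of_mem hm, timeFactor_of_mem (mem_sdiff_of_mem hm hn)]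
    · rw [timeFactor_of_notMem hm, timeFactor_of_notMem (fun h => hm h.1)]
  have hge : 1 ≤ (1 + ε) * survival X (Ioc t s) := by
    have h0 := survival_nonneg X (Ioc t s)
    have : survival X (Iic (t + 1))
        ≤ (1 + ε) * survival X (Ioc t s) * survival X (Iic (t + 1)) := by
      calc survival X (Iic (t + 1)) = _ := hsplit
        _ ≤ (1 + ε) * survival X (Iic (t + 1)) * survival X (Ioc t s) := by gcongr
        _ = _ := by ring
    exact le_of_mul_le_mul_right (by linarith) hT
  rw [hX.subordinator_eq, hX.subordinator_eq, survival_Iic_mul_Ioc X hs.1]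
  have h1 := hX.pos t
  have h2 := survival_le_one X (Iic t)
  have h3 := survival_le_one X (Ioc t s)
  have h4 := survival_nonneg X (Ioc t s)
  -- `1 - V ≤ ε V` and `Q ≤ 1` bound the increment `Q (1 - V)`
  have h5 : 1 - survival X (Ioc t s) < ε := by
    rcases h3.lt_or_eq with h | h
    · nlinarith
    · rw [h]; linarith
  nlinarith

end IsRegular

end Survival

/-! ### Joint moments of survival factors -/

section Moments

variable {θ : ℝ}

/-- The length of the part of `J` in `[0,∞)`. -/
def timeLength (J : Set ℝ) : ℝ := (volume.restrict (Ici (0 : ℝ))).real J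

theorem timeLength_Ioc {a b : ℝ} (ha : 0 ≤ a) (hab : a ≤ b) : timeLength (Ioc a b) = b - a := by
  have h : Ioc a b ∩ Ici 0 = Ioc a b :=
    inter_eq_left.mpr fun x hx => (ha.trans hx.1.le)
  rw [timeLength, measureReal_restrict_apply measurableSet_Ioc, h, Real.volume_real_Ioc_of_le hab]

theorem timeLength_Iic {t : ℝ} (ht : 0 ≤ t) : timeLength (Iic t) = t := by
  rw [timeLength, measureReal_restrict_apply measurableSet_Iic, Iic_inter_Ici,
    Real.volume_real_Icc_of_le ht, sub_zero]

theorem volume_Ici_inter_Ioc_ne_top (a b : ℝ) :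
    (volume.restrict (Ici (0 : ℝ))) (Ioc a b) ≠ ⊤ :=
  ((Measure.restrict_apply_le _ _).trans_lt (by simp)).ne

theorem volume_Ici_inter_Iic_ne_top (t : ℝ) :
    (volume.restrict (Ici (0 : ℝ))) (Iic t) ≠ ⊤ := by
  rw [Measure.restrict_apply measurableSet_Iic, Iic_inter_Ici]
  exact measure_Icc_lt_top.ne

theorem integral_one_sub_timeFactor {J : Set ℝ} (hJ : MeasurableSet J)
    (hfin : (volume.restrict (Ici (0 : ℝ))) J ≠ ⊤) {ψ : ℝ → ℝ}
    (hψ : Integrable (fun z => 1 - ψ z) (breakMeasure θ)) :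
    Integrable (fun p => 1 - timeFactor J ψ p) (stripIntensity θ) ∧
      ∫ p, (1 - timeFactor J ψ p) ∂(stripIntensity θ)
        = timeLength J * ∫ z, (1 - ψ z) ∂(breakMeasure θ) := by
  simp_rw [one_sub_timeFactor]
  have hi : Integrable (J.indicator (1 : ℝ → ℝ)) (volume.restrict (Ici (0 : ℝ))) :=
    (integrable_indicator_iff hJ).mpr (integrableOn_const hfin)
  refine ⟨hi.mul_prod hψ, ?_⟩
  rw [stripIntensity, integral_prod_mul (J.indicator (1 : ℝ → ℝ)) (fun z => 1 - ψ z),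
    integral_indicator_one hJ]
  rfl

theorem integral_one_sub_stay_pow (hθ : 0 < θ) (n : ℕ) :
    Integrable (fun z => 1 - stay z ^ n) (breakMeasure θ) ∧
      ∫ z, (1 - stay z ^ n) ∂(breakMeasure θ) = genHarmonic θ n := by
  have h : (fun z => 1 - (1 - z) ^ n) =ᵐ[breakMeasure θ] fun z => 1 - stay z ^ n := by
    filter_upwards [ae_breakMeasure_mem_Ioo θ] with z hz
    rw [stay_of_mem (Ioo_subset_Icc_self hz)]
  obtain ⟨h1, h2⟩ := integral_one_sub_one_sub_pow hθ n
  exact ⟨h1.congr h, by rw [← integral_congr_ae h, h2]⟩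

variable {Ω : Type*} [MeasurableSpace Ω] {P : Measure Ω} [IsProbabilityMeasure P]
  {X : Ω → Set (ℝ × ℝ)}

theorem stay_pow_le_one (n : ℕ) (z : ℝ) : stay z ^ n ≤ 1 := pow_le_one₀ (stay_nonneg z) (stay_le_one z)

theorem aemeasurable_survival (hθ : 0 < θ) (hX : IsPoissonProcess P X (stripIntensity θ))
    {J : Set ℝ} (hJ : MeasurableSet J) (hfin : (volume.restrict (Ici (0 : ℝ))) J ≠ ⊤) :
    AEMeasurable (fun ω => survival (X ω) J) P := by
  have hψ : Integrable (fun z => 1 - stay z) (breakMeasure θ) := by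
    simpa using (integral_one_sub_stay_pow hθ 1).1
  exact (hX.laplace (measurable_timeFactor hJ measurable_stay) (timeFactor_nonneg J stay_nonneg)
    (timeFactor_le_one J stay_le_one) (integral_one_sub_timeFactor hJ hfin hψ).1).1

/-- Over disjoint time sets the survival factors are independent, with moments given by the
Laplace exponent `h_θ`. -/
theorem integral_prod_survival_pow (hθ : 0 < θ) (hX : IsPoissonProcess P X (stripIntensity θ))
    {ι : Type*} [Fintype ι] {J : ι → Set ℝ} (hJ : ∀ i, MeasurableSet (J i))
    (hfin : ∀ i, (volume.restrict (Ici (0 : ℝ))) (J i) ≠ ⊤)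
    (hd : Pairwise fun i j => Disjoint (J i) (J j)) (e : ι → ℕ) :
    ∫ ω, ∏ i, survival (X ω) (J i) ^ e i ∂P
      = ∏ i, Real.exp (-(timeLength (J i) * genHarmonic θ (e i))) := by
  classical
  set φ : ι → ℝ × ℝ → ℝ := fun i => timeFactor (J i) (fun z => stay z ^ e i) with hφ
  have h0 : ∀ i p, 0 ≤ φ i p := fun i => timeFactor_nonneg _ fun z => pow_nonneg (stay_nonneg z) _
  have h1 : ∀ i p, φ i p ≤ 1 := fun i => timeFactor_le_one _ (stay_pow_le_one _)
  have hint := fun i => integral_one_sub_timeFactor (hJ i) (hfin i)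
    (integral_one_sub_stay_pow hθ (e i)).1
  have hprod : ∀ ω, ∏ i, survival (X ω) (J i) ^ e i
      = atomProduct (X ω) (fun p => ∏ i, φ i p) := by
    intro ω
    rw [atomProduct_finset_prod _ _ h0 h1]
    refine Finset.prod_congr rfl fun i _ => ?_
    rw [survival, ← atomProduct_pow (timeFactor_nonneg _ stay_nonneg)
      (timeFactor_le_one _ stay_le_one)]
    congr 1
    funext p
    by_cases hp : p.1 ∈ J i
    · rw [hφ]; simp only [timeFactor_of_mem hp]
    · rw [hφ]; simp only [timeFactor_of_notMem hp, one_pow]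
  -- the factors `φ i` differ from `1` on disjoint sets
  have hsum : (fun p => 1 - ∏ i, φ i p) = fun p => ∑ i, (1 - φ i p) := by
    funext p
    by_cases h : ∃ i, p.1 ∈ J i
    · obtain ⟨i, hi⟩ := h
      have hne : ∀ j, j ≠ i → φ j p = 1 := fun j hj =>
        timeFactor_of_notMem (fun h => Set.disjoint_left.mp (hd hj) h hi) _
      rw [Finset.prod_eq_single i (fun j _ hj => hne j hj) (by simp),
        Finset.sum_eq_single i (fun j _ hj => by rw [hne j hj, sub_self]) (by simp)]
    · have hne : ∀ j, φ j p = 1 := fun j => timeFactor_of_notMem (fun hj => h ⟨j, hj⟩) _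
      simp [hne]
  have hl := hX.laplace (f := fun p => ∏ i, φ i p)
    (Finset.measurable_prod _ fun i _ => measurable_timeFactor (hJ i) (measurable_stay.pow_const _))
    (fun p => Finset.prod_nonneg fun i _ => h0 i p)
    (fun p => Finset.prod_le_one (fun i _ => h0 i p) fun i _ => h1 i p)
    (by rw [hsum]; exact integrable_finsetSum _ fun i _ => (hint i).1)
  simp_rw [hprod]
  rw [hl.2, hsum, integral_finsetSum _ fun i _ => (hint i).1, ← Finset.sum_neg_distrib,
    Real.exp_sum]
  refine Finset.prod_congr rfl fun i _ => ?_
  rw [(hint i).2, (integral_one_sub_stay_pow hθ (e i)).2]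

/-- The mean of `p V`, where `V` is the survival factor over a time set of length `v`. -/
def polyMean (θ v : ℝ) (p : Polynomial ℝ) : ℝ :=
  ∑ k ∈ Finset.range (p.natDegree + 1), p.coeff k * Real.exp (-(v * genHarmonic θ k))

theorem polyMean_X_pow (θ v : ℝ) (n : ℕ) :
    polyMean θ v (Polynomial.X ^ n) = Real.exp (-(v * genHarmonic θ n)) := by
  rw [polyMean, Polynomial.natDegree_X_pow, Finset.sum_eq_single n]
  · simp
  · intro k _ hk
    simp [Polynomial.coeff_X_pow, hk]
  · simp

theorem integral_prod_polynomial_survival (hθ : 0 < θ)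
    (hX : IsPoissonProcess P X (stripIntensity θ))
    {ι : Type*} [Fintype ι] {J : ι → Set ℝ} (hJ : ∀ i, MeasurableSet (J i))
    (hfin : ∀ i, (volume.restrict (Ici (0 : ℝ))) (J i) ≠ ⊤)
    (hd : Pairwise fun i j => Disjoint (J i) (J j)) (p : ι → Polynomial ℝ) :
    ∫ ω, ∏ i, (p i).eval (survival (X ω) (J i)) ∂P
      = ∏ i, polyMean θ (timeLength (J i)) (p i) := by
  classical
  simp_rw [polyMean, Polynomial.eval_eq_sum_range, Finset.prod_univ_sum, Finset.prod_mul_distrib]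
  have hint : ∀ e : ι → ℕ, Integrable (fun ω => ∏ i, survival (X ω) (J i) ^ e i) P := by
    intro e
    refine Integrable.of_bound (C := 1) ?_ (Eventually.of_forall fun ω => ?_)
    · exact (Finset.aemeasurable_fun_prod _ fun i _ =>
        (aemeasurable_survival hθ hX (hJ i) (hfin i)).pow_const _).aestronglyMeasurable
    · rw [Real.norm_of_nonneg (Finset.prod_nonneg fun i _ => pow_nonneg (survival_nonneg _ _) _)]
      exact Finset.prod_le_one (fun i _ => pow_nonneg (survival_nonneg _ _) _)
        fun i _ => pow_le_one₀ (survival_nonneg _ _) (survival_le_one _ _)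
  rw [integral_finsetSum _ fun e _ => (hint e).const_mul _]
  refine Finset.sum_congr rfl fun e _ => ?_
  rw [integral_const_mul, integral_prod_survival_pow hθ hX hJ hfin hd e]

theorem tendsto_mul_exp_sub_one (x : ℝ) :
    Tendsto (fun m : ℕ => ((m : ℝ) + 1) * (Real.exp (-(1 / ((m : ℝ) + 1) * x)) - 1)) atTop
      (𝓝 (-x)) := by
  have hd : HasDerivAt (fun t : ℝ => Real.exp (-(t * x))) (-x) 0 := by
    have := (((hasDerivAt_id (0 : ℝ)).mul_const x).neg).exp
    simpa using this
  have h := hd.tendsto_slope_zero_right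
  have hm : Tendsto (fun m : ℕ => 1 / ((m : ℝ) + 1)) atTop (𝓝[>] 0) :=
    tendsto_nhdsWithin_iff.mpr ⟨tendsto_one_div_add_atTop_nhds_zero_nat,
      Eventually.of_forall fun m => by rw [mem_Ioi]; positivity⟩
  refine (h.comp hm).congr fun m => ?_
  simp

/-- The mean of `V^b (1-V)^(a+1)` over a short time `v` is `v ∫ z^(a+1) (1-z)^b dω` to first
order: a single atom then carries the whole increment. -/
theorem tendsto_polyMean_div (hθ : 0 < θ) (a b : ℕ) :
    Tendsto (fun m : ℕ => ((m : ℝ) + 1) * polyMean θ (1 / ((m : ℝ) + 1))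
        ((1 - Polynomial.X) ^ (a + 1) * Polynomial.X ^ b)) atTop
      (𝓝 (a.factorial * (ascPochhammer ℝ b).eval θ / (ascPochhammer ℝ (a + b + 1)).eval θ)) := by
  set p : Polynomial ℝ := (1 - Polynomial.X) ^ (a + 1) * Polynomial.X ^ b with hp
  have hev : ∀ x : ℝ, p.eval x = (1 - x) ^ (a + 1) * x ^ b := fun x => by simp [hp]
  have hI : -∑ k ∈ Finset.range (p.natDegree + 1), p.coeff k * genHarmonic θ k
      = a.factorial * (ascPochhammer ℝ b).eval θ / (ascPochhammer ℝ (a + b + 1)).eval θ := by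
    rw [← integral_polynomial_sub hθ p, ← (integral_pow_mul_one_sub_pow hθ a b).2]
    congr 1
    funext z
    rw [hev, hev]; simp
  have h1 : ∑ k ∈ Finset.range (p.natDegree + 1), p.coeff k = 0 := by
    have := hev 1
    rw [Polynomial.eval_eq_sum_range] at this
    simpa using this
  rw [← hI, ← Finset.sum_neg_distrib]
  have hrw : ∀ m : ℕ, ((m : ℝ) + 1) * polyMean θ (1 / ((m : ℝ) + 1)) p
      = ∑ k ∈ Finset.range (p.natDegree + 1),
        p.coeff k * (((m : ℝ) + 1) * (Real.exp (-(1 / ((m : ℝ) + 1) * genHarmonic θ k)) - 1)) := by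
    intro m
    have : ∀ k, p.coeff k * (((m : ℝ) + 1) *
        (Real.exp (-(1 / ((m : ℝ) + 1) * genHarmonic θ k)) - 1))
        = ((m : ℝ) + 1) * (p.coeff k * Real.exp (-(1 / ((m : ℝ) + 1) * genHarmonic θ k)))
          - ((m : ℝ) + 1) * p.coeff k := fun k => by ring
    simp_rw [this]
    rw [Finset.sum_sub_distrib, ← Finset.mul_sum, ← Finset.mul_sum, h1, mul_zero, sub_zero]
    rfl
  simp_rw [hrw]
  refine tendsto_finsetSum _ fun k _ => ?_
  rw [← mul_neg]
  exact (tendsto_mul_exp_sub_one _).const_mul _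

end Moments

/-! ### Almost sure regularity of the path -/

section Regular

variable {θ : ℝ} {Ω : Type*} [MeasurableSpace Ω] {P : Measure Ω} [IsProbabilityMeasure P]
  {X : Ω → Set (ℝ × ℝ)}

omit [IsProbabilityMeasure P] in
theorem ae_subset_strip (hX : IsPoissonProcess P X (stripIntensity θ)) :
    ∀ᵐ ω ∂P, X ω ⊆ Ioi 0 ×ˢ Ioo 0 1 := by
  have hA : MeasurableSet ((Ioi (0 : ℝ) ×ˢ Ioo (0 : ℝ) 1)ᶜ) :=
    (measurableSet_Ioi.prod measurableSet_Ioo).compl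
  have hμ : stripIntensity θ ((Ioi (0 : ℝ) ×ˢ Ioo (0 : ℝ) 1)ᶜ) = 0 := by
    have h1 : ∀ᵐ t ∂(volume.restrict (Ici (0 : ℝ))), t ∈ Ioi (0 : ℝ) := by
      rw [← restrict_Ioi_eq_restrict_Ici]
      exact ae_restrict_mem measurableSet_Ioi
    have h2 := ae_breakMeasure_mem_Ioo θ
    have h : ∀ᵐ p ∂(stripIntensity θ), p ∈ Ioi (0 : ℝ) ×ˢ Ioo (0 : ℝ) 1 := by
      filter_upwards [Measure.quasiMeasurePreserving_fst.ae h1,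
        Measure.quasiMeasurePreserving_snd.ae h2] with p hp1 hp2
      exact ⟨hp1, hp2⟩
    exact h
  have hm := hX.measurable_count _ hA
  have h := hX.law_count _ hA (by rw [hμ]; exact ENNReal.zero_ne_top)
  have h0 : P.map (fun ω => (X ω ∩ (Ioi (0 : ℝ) ×ˢ Ioo (0 : ℝ) 1)ᶜ).encard) {0}ᶜ = 0 := by
    rw [h, hμ, Measure.map_apply measurable_from_top (measurableSet_singleton _).compl]
    have : (fun k : ℕ => (k : ℕ∞)) ⁻¹' {0}ᶜ = {0}ᶜ := by ext k; simp
    rw [this, ENNReal.toNNReal_zero]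
    rw [← ofReal_measureReal, probReal_compl_eq_one_sub (measurableSet_singleton _),
      poissonMeasure_real_singleton]
    simp
  rw [Measure.map_apply hm (measurableSet_singleton _).compl] at h0
  have h0' : ∀ᵐ ω ∂P, (X ω ∩ (Ioi (0 : ℝ) ×ˢ Ioo (0 : ℝ) 1)ᶜ).encard = 0 := by
    rw [ae_iff]; exact h0
  filter_upwards [h0'] with ω hω p hp
  by_contra hn
  exact Set.eq_empty_iff_forall_notMem.mp (Set.encard_eq_zero.mp hω) p ⟨hp, hn⟩

/-- No survival factor vanishes: as `s ↓ 0` the mean of its `s`-th power tends to `1`. -/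
theorem ae_survival_pos (hθ : 0 < θ) (hX : IsPoissonProcess P X (stripIntensity θ)) (t : ℝ) :
    ∀ᵐ ω ∂P, 0 < survival (X ω) (Iic t) := by
  have hJ : MeasurableSet (Iic t) := measurableSet_Iic
  have hfin := volume_Ici_inter_Iic_ne_top t
  set s : ℕ → ℝ := fun n => 1 / ((n : ℝ) + 1) with hs
  have hs0 : ∀ n, 0 < s n := fun n => by rw [hs]; positivity
  have hs1 : ∀ n, s n ≤ 1 := fun n => by
    rw [hs]; simp only; rw [div_le_one (by positivity)]; linarith [(Nat.cast_nonneg n : (0:ℝ) ≤ n)]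
  have hr1 : ∀ n z, stay z ^ s n ≤ 1 := fun n z =>
    Real.rpow_le_one (stay_nonneg z) (stay_le_one z) (hs0 n).le
  have hmeas : ∀ n, Measurable fun z => stay z ^ s n := fun n => measurable_stay.pow_const _
  have hbase : Integrable (fun z => 1 - stay z) (breakMeasure θ) := by
    simpa using (integral_one_sub_stay_pow hθ 1).1
  have hbd : ∀ n z, ‖1 - stay z ^ s n‖ ≤ 1 - stay z := fun n z => by
    rw [Real.norm_of_nonneg (by linarith [hr1 n z])]
    have := Real.rpow_le_rpow_of_exponent_ge_of_imp (stay_nonneg z) (stay_le_one z) (hs1 n)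
      (fun _ h => absurd h one_ne_zero)
    rw [Real.rpow_one] at this
    linarith
  have hint : ∀ n, Integrable (fun z => 1 - stay z ^ s n) (breakMeasure θ) := fun n =>
    hbase.mono' (measurable_const.sub (hmeas n)).aestronglyMeasurable
      (Eventually.of_forall (hbd n))
  have hlim : Tendsto (fun n => ∫ z, (1 - stay z ^ s n) ∂(breakMeasure θ)) atTop (𝓝 0) := by
    rw [show (0 : ℝ) = ∫ z, (0 : ℝ) ∂(breakMeasure θ) by simp]
    refine tendsto_integral_of_dominated_convergence (fun z => 1 - stay z)
      (fun n => (hint n).aestronglyMeasurable) hbase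
      (fun n => Eventually.of_forall (hbd n)) ?_
    filter_upwards [ae_breakMeasure_mem_Ioo θ] with z hz
    have hpos : 0 < stay z := by
      rw [stay_of_mem (Ioo_subset_Icc_self hz)]; linarith [hz.2]
    have h1 : Tendsto (fun n => stay z ^ s n) atTop (𝓝 (stay z ^ (0 : ℝ))) :=
      ((Real.continuous_const_rpow hpos.ne').tendsto 0).comp
        tendsto_one_div_add_atTop_nhds_zero_nat
    rw [Real.rpow_zero] at h1
    simpa using h1.const_sub 1
  -- a power of the survival factor is at most the indicator of the event that it is positive
  have hkey : ∀ n, Real.exp (-(timeLength (Iic t) * ∫ z, (1 - stay z ^ s n) ∂(breakMeasure θ)))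
      ≤ 1 - P.real {ω | ¬ 0 < survival (X ω) (Iic t)} := by
    intro n
    have hI := integral_one_sub_timeFactor hJ hfin (hint n)
    have hl := hX.laplace (measurable_timeFactor hJ (hmeas n))
      (timeFactor_nonneg _ fun z => Real.rpow_nonneg (stay_nonneg z) _)
      (timeFactor_le_one _ (hr1 n)) hI.1
    rw [← hI.2, ← hl.2]
    have hpow : ∀ ω, atomProduct (X ω) (timeFactor (Iic t) fun z => stay z ^ s n)
        = survival (X ω) (Iic t) ^ s n := by
      intro ω
      rw [survival, ← atomProduct_rpow (timeFactor_nonneg _ stay_nonneg)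
        (timeFactor_le_one _ stay_le_one) (hs0 n).le]
      congr 1
      funext p
      by_cases hp : p.1 ∈ Iic t
      · simp only [timeFactor_of_mem hp]
      · simp only [timeFactor_of_notMem hp, Real.one_rpow]
    have hnull : NullMeasurableSet {ω | ¬ 0 < survival (X ω) (Iic t)} P :=
      (nullMeasurableSet_lt aemeasurable_const (aemeasurable_survival hθ hX hJ hfin)).compl
    have hind : P.real {ω | ¬ 0 < survival (X ω) (Iic t)}ᶜ
        = ∫ ω, {ω | ¬ 0 < survival (X ω) (Iic t)}ᶜ.indicator (fun _ => (1 : ℝ)) ω ∂P := by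
      rw [integral_indicator₀ hnull.compl, setIntegral_const, smul_eq_mul, mul_one]
    rw [← probReal_compl_eq_one_sub₀ hnull, hind]
    refine integral_mono_of_nonneg (Eventually.of_forall fun ω => ?_)
      ((integrable_const (1 : ℝ)).indicator₀ hnull.compl) (Eventually.of_forall fun ω => ?_)
    · simp only [hpow]; exact Real.rpow_nonneg (survival_nonneg _ _) _
    · simp only [hpow]
      by_cases hω : 0 < survival (X ω) (Iic t)
      · rw [indicator_of_mem (by simpa using hω)]
        exact Real.rpow_le_one (survival_nonneg _ _) (survival_le_one _ _) (hs0 n).le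
      · have h0 : survival (X ω) (Iic t) = 0 := le_antisymm (not_lt.mp hω) (survival_nonneg _ _)
        rw [indicator_of_notMem (by simpa using hω), h0, Real.zero_rpow (hs0 n).ne']
  have h1 : Tendsto (fun n => Real.exp (-(timeLength (Iic t) *
      ∫ z, (1 - stay z ^ s n) ∂(breakMeasure θ)))) atTop (𝓝 1) := by
    have := (Real.continuous_exp.tendsto _).comp (hlim.const_mul (timeLength (Iic t))).neg
    rw [mul_zero, neg_zero, Real.exp_zero] at this
    exact this
  have h2 := le_of_tendsto' h1 hkey
  have h3 : P.real {ω | ¬ 0 < survival (X ω) (Iic t)} = 0 :=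
    le_antisymm (by linarith) measureReal_nonneg
  rw [ae_iff]
  exact (measureReal_eq_zero_iff).mp h3

/-- The survival factor up to time `n` has mean `exp (-n h_θ(1))`, hence tends to `0`. -/
theorem ae_exists_survival_lt (hθ : 0 < θ) (hX : IsPoissonProcess P X (stripIntensity θ)) :
    ∀ᵐ ω ∂P, ∀ ε > 0, ∃ t, survival (X ω) (Iic t) < ε := by
  set Y : Ω → ℝ := fun ω => ⨅ n : ℕ, survival (X ω) (Iic (n : ℝ)) with hY
  have hb : ∀ ω, BddBelow (range fun n : ℕ => survival (X ω) (Iic (n : ℝ))) := fun ω =>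
    ⟨0, by rintro _ ⟨n, rfl⟩; exact survival_nonneg _ _⟩
  have hm : ∀ n : ℕ, AEMeasurable (fun ω => survival (X ω) (Iic (n : ℝ))) P := fun n =>
    aemeasurable_survival hθ hX measurableSet_Iic (volume_Ici_inter_Iic_ne_top _)
  have hlim : ∀ ω, Tendsto (fun n : ℕ => survival (X ω) (Iic (n : ℝ))) atTop (𝓝 (Y ω)) := fun ω =>
    tendsto_atTop_ciInf (fun m n h => antitone_survival_Iic (X ω) (by exact_mod_cast h)) (hb ω)
  have hY0 : ∀ ω, 0 ≤ Y ω := fun ω => le_ciInf fun n => survival_nonneg _ _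
  have hYm : AEMeasurable Y P := aemeasurable_of_tendsto_metrizable_ae atTop hm
    (Eventually.of_forall hlim)
  have hY1 : ∀ ω, Y ω ≤ 1 := fun ω => (ciInf_le (hb ω) 0).trans (survival_le_one _ _)
  have hE : Tendsto (fun n : ℕ => ∫ ω, survival (X ω) (Iic (n : ℝ)) ∂P) atTop
      (𝓝 (∫ ω, Y ω ∂P)) :=
    tendsto_integral_of_dominated_convergence (fun _ => 1)
      (fun n => (hm n).aestronglyMeasurable) (integrable_const 1)
      (fun n => Eventually.of_forall fun ω => by
        rw [Real.norm_of_nonneg (survival_nonneg _ _)]; exact survival_le_one _ _)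
      (Eventually.of_forall hlim)
  have hval : ∀ n : ℕ, ∫ ω, survival (X ω) (Iic (n : ℝ)) ∂P
      = Real.exp (-(genHarmonic θ 1 * n)) := by
    intro n
    have := integral_prod_survival_pow hθ hX (ι := Unit) (J := fun _ => Iic (n : ℝ))
      (fun _ => measurableSet_Iic) (fun _ => volume_Ici_inter_Iic_ne_top _)
      (fun i j h => absurd (Subsingleton.elim i j) h) (fun _ => 1)
    simpa [timeLength_Iic, mul_comm] using this
  have h0 : Tendsto (fun n : ℕ => Real.exp (-(genHarmonic θ 1 * n))) atTop (𝓝 0) := by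
    refine Real.tendsto_exp_neg_atTop_nhds_zero.comp ?_
    exact tendsto_natCast_atTop_atTop.const_mul_atTop (genHarmonic_pos hθ one_pos)
  simp_rw [hval] at hE
  have hYint : ∫ ω, Y ω ∂P = 0 := tendsto_nhds_unique hE h0
  have hYi : Integrable Y P := Integrable.of_bound (C := 1) hYm.aestronglyMeasurable
    (Eventually.of_forall fun ω => by rw [Real.norm_of_nonneg (hY0 ω)]; exact hY1 ω)
  have hae := (integral_eq_zero_iff_of_nonneg hY0 hYi).mp hYint
  filter_upwards [hae] with ω hω ε hε
  have h := hlim ω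
  rw [hω] at h
  obtain ⟨n, hn⟩ := (h.eventually (gt_mem_nhds hε)).exists
  exact ⟨n, hn⟩

theorem ae_isRegular (hθ : 0 < θ) (hX : IsPoissonProcess P X (stripIntensity θ)) :
    ∀ᵐ ω ∂P, IsRegular (X ω) := by
  have hpos : ∀ᵐ ω ∂P, ∀ n : ℕ, 0 < survival (X ω) (Iic (n : ℝ)) :=
    ae_all_iff.mpr fun n => ae_survival_pos hθ hX n
  filter_upwards [ae_subset_strip hX, hpos, ae_exists_survival_lt hθ hX] with ω h1 h2 h3
  refine ⟨h1, fun t => ?_, h3⟩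
  obtain ⟨n, hn⟩ := exists_nat_ge t
  exact (h2 n).trans_le (antitone_survival_Iic (X ω) hn)

end Regular

/-! ### The range of the subordinator and its complement -/

section Paintbox

variable {X : Set (ℝ × ℝ)}

namespace IsRegular

/-- By right-continuity the values of the path at the times `k / (m+1)` approximate its value at
`t` from above. -/
theorem eventually_exists_grid (hX : IsRegular X) {t : ℝ} (ht : 0 ≤ t) {ε : ℝ} (hε : 0 < ε) :
    ∀ᶠ m : ℕ in atTop, ∃ k : ℕ, t ≤ k / ((m : ℝ) + 1) ∧
      subordinator X (k / ((m : ℝ) + 1)) < subordinator X t + ε := by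
  obtain ⟨δ, hδ, h⟩ := hX.exists_lt_add t hε
  have hm : ∀ᶠ m : ℕ in atTop, 1 / ((m : ℝ) + 1) < δ :=
    tendsto_one_div_add_atTop_nhds_zero_nat.eventually (gt_mem_nhds hδ)
  filter_upwards [hm] with m hm
  have hpos : (0 : ℝ) < m + 1 := by positivity
  have h1 : t ≤ (⌈t * (m + 1)⌉₊ : ℝ) / ((m : ℝ) + 1) := by
    rw [le_div_iff₀ hpos]; exact Nat.le_ceil _
  have h2 : (⌈t * (m + 1)⌉₊ : ℝ) / ((m : ℝ) + 1) ≤ t + δ := by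
    have h3 := (Nat.ceil_lt_add_one (a := t * ((m : ℝ) + 1)) (by positivity)).le
    have h4 : (⌈t * (m + 1)⌉₊ : ℝ) / ((m : ℝ) + 1) ≤ t + 1 / ((m : ℝ) + 1) := by
      rw [div_le_iff₀ hpos, add_mul t, div_mul_cancel₀ _ hpos.ne']
      exact h3
    linarith
  exact ⟨_, h1, h _ ⟨h1, h2⟩⟩

theorem exists_grid_mem_Ioo (hX : IsRegular X) {t a b : ℝ} (ht : 0 < t)
    (h : subordinator X t ∈ Ioo a b) :
    ∃ m k : ℕ, 0 < k ∧ subordinator X (k / ((m : ℝ) + 1)) ∈ Ioo a b := by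
  obtain ⟨m, k, h1, h2⟩ := (hX.eventually_exists_grid ht.le (sub_pos.mpr h.2)).exists
  refine ⟨m, k, ?_, h.1.trans_le (hX.monotone h1), by linarith⟩
  rcases Nat.eq_zero_or_pos k with rfl | hk
  · simp at h1; linarith
  · exact hk

theorem zero_mem_closure (hX : IsRegular X) : (0 : ℝ) ∈ closure (subordinator X '' Ioi 0) := by
  rw [Metric.mem_closure_iff]
  intro ε hε
  obtain ⟨δ, hδ, h⟩ := hX.exists_lt_add 0 hε
  refine ⟨_, ⟨δ, hδ, rfl⟩, ?_⟩
  have := h δ ⟨hδ.le, by linarith⟩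
  rw [hX.subordinator_zero, zero_add] at this
  rw [dist_comm, Real.dist_eq, sub_zero, abs_of_nonneg (hX.mem_Ico _).1]
  exact this

theorem one_mem_closure (hX : IsRegular X) : (1 : ℝ) ∈ closure (subordinator X '' Ioi 0) := by
  rw [Metric.mem_closure_iff]
  intro ε hε
  obtain ⟨t, ht⟩ := hX.exists_lt ε hε
  refine ⟨_, ⟨max t 1, mem_Ioi.mpr (lt_max_of_lt_right one_pos), rfl⟩, ?_⟩
  have h1 := hX.monotone (le_max_left t 1)
  rw [hX.subordinator_eq t] at h1
  rw [Real.dist_eq, abs_of_nonneg (by linarith [(hX.mem_Ico (max t 1)).2])]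
  linarith

theorem isOpen_rangeComplement (hX : IsRegular X) : IsOpen (rangeComplement X) := by
  have h : rangeComplement X = Ioo 0 1 \ closure (subordinator X '' Ioi 0) := by
    ext x
    refine ⟨fun hx => ⟨⟨?_, ?_⟩, hx.2⟩, fun hx => ⟨Ioo_subset_Icc_self hx.1, hx.2⟩⟩
    · refine lt_of_le_of_ne hx.1.1 fun h => hx.2 ?_
      rw [← h]; exact hX.zero_mem_closure
    · refine lt_of_le_of_ne hx.1.2 fun h => hx.2 ?_
      rw [h]; exact hX.one_mem_closure
  rw [h]
  exact isOpen_Ioo.sdiff isClosed_closure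

theorem Icc_subset_rangeComplement_iff (hX : IsRegular X) {a b : ℝ} (h0 : 0 ≤ a) (h1 : b ≤ 1) :
    Icc a b ⊆ rangeComplement X ↔ a ≤ b → ∃ r : ℕ, ∀ m k : ℕ, 0 < k →
      subordinator X (k / ((m : ℝ) + 1)) ∉ Ioo (a - 1 / ((r : ℝ) + 1)) (b + 1 / ((r : ℝ) + 1)) := by
  constructor
  · intro h hab
    have hd : Disjoint (Icc a b) (closure (subordinator X '' Ioi 0)) :=
      Set.disjoint_left.mpr fun x hx => (h hx).2
    obtain ⟨δ, hδ, hdis⟩ := hd.exists_thickenings isCompact_Icc isClosed_closure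
    obtain ⟨r, hr⟩ := exists_nat_one_div_lt hδ
    refine ⟨r, fun m k hk hm => ?_⟩
    have hk' : (k : ℝ) / ((m : ℝ) + 1) ∈ Ioi (0 : ℝ) := by rw [mem_Ioi]; positivity
    refine Set.disjoint_left.mp hdis ?_
      (Metric.self_subset_thickening hδ _ (subset_closure (mem_image_of_mem _ hk')))
    · rw [Metric.mem_thickening_iff]
      set y := subordinator X (k / ((m : ℝ) + 1))
      refine ⟨max a (min y b), ⟨le_max_left _ _, max_le hab (min_le_right _ _)⟩, ?_⟩
      rw [Real.dist_eq, abs_lt]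
      obtain ⟨hy1, hy2⟩ := hm
      constructor
      · rcases max_cases a (min y b) with h | h <;> rcases min_cases y b with h' | h' <;> linarith
      · rcases max_cases a (min y b) with h | h <;> rcases min_cases y b with h' | h' <;> linarith
  · intro h x hx
    obtain ⟨r, hr⟩ := h (hx.1.trans hx.2)
    refine ⟨⟨h0.trans hx.1, hx.2.trans h1⟩, fun hc => ?_⟩
    have hr0 : 0 < 1 / ((r : ℝ) + 1) := by positivity
    obtain ⟨_, hy, t, ht, rfl⟩ := mem_closure_iff.mp hc _ isOpen_Ioo
      (show x ∈ Ioo (a - 1 / ((r : ℝ) + 1)) (b + 1 / ((r : ℝ) + 1)) from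
        ⟨by linarith [hx.1], by linarith [hx.2]⟩)
    obtain ⟨m, k, hk, hmem⟩ := hX.exists_grid_mem_Ioo ht hy
    exact hr m k hk hmem

end IsRegular

variable {θ : ℝ} {Ω : Type*} [MeasurableSpace Ω] {P : Measure Ω} [IsProbabilityMeasure P]
  {X : Ω → Set (ℝ × ℝ)}

/-- A measurable version of the path at the times `k / (m+1)`, with values in `[0,1]` and
increasing in `k` everywhere. -/
theorem exists_gridPath (hθ : 0 < θ) (hX : IsPoissonProcess P X (stripIntensity θ)) :
    ∃ T : ℕ → ℕ → Ω → ℝ, (∀ m k, Measurable (T m k)) ∧ (∀ m ω, Monotone fun k => T m k ω) ∧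
      (∀ m k ω, T m k ω ∈ Icc 0 1) ∧
      ∀ᵐ ω ∂P, IsRegular (X ω) ∧
        ∀ m k : ℕ, T m k ω = subordinator (X ω) (k / ((m : ℝ) + 1)) := by
  have hreg := ae_isRegular hθ hX
  have hm : ∀ m k : ℕ, AEMeasurable (fun ω => subordinator (X ω) (k / ((m : ℝ) + 1))) P := by
    intro m k
    refine ((aemeasurable_survival hθ hX (measurableSet_Iic (a := k / ((m : ℝ) + 1)))
      (volume_Ici_inter_Iic_ne_top _)).const_sub 1).congr ?_
    filter_upwards [hreg] with ω hω
    rw [hω.subordinator_eq]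
  have hall : ∀ᵐ ω ∂P, IsRegular (X ω) ∧
      ∀ m k : ℕ, subordinator (X ω) (k / ((m : ℝ) + 1)) = (hm m k).mk _ ω :=
    hreg.and (ae_all_iff.mpr fun m => ae_all_iff.mpr fun k => (hm m k).ae_eq_mk)
  -- restricting to a measurable set of full measure makes monotonicity and bounds hold everywhere
  obtain ⟨G, hG, hGm, hGs⟩ := hall.exists_measurable_mem
  have hval : ∀ m k ω, ω ∈ G →
      G.indicator ((hm m k).mk _) ω = subordinator (X ω) (k / ((m : ℝ) + 1)) :=
    fun m k ω hω => by rw [indicator_of_mem hω, ((hGs ω hω).2 m k)]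
  refine ⟨fun m k => G.indicator ((hm m k).mk _),
    fun m k => (hm m k).measurable_mk.indicator hGm, fun m ω i j hij => ?_, fun m k ω => ?_, ?_⟩
  · by_cases hω : ω ∈ G
    · simp only [hval _ _ _ hω]
      exact (hGs ω hω).1.monotone (by gcongr)
    · simp [hω]
  · by_cases hω : ω ∈ G
    · simp only [hval _ _ _ hω]
      exact Ico_subset_Icc_self ((hGs ω hω).1.mem_Ico _)
    · simp [hω]
  · filter_upwards [hG] with ω hω
    exact ⟨(hGs ω hω).1, fun m k => hval m k ω hω⟩

theorem isPaintbox_rangeComplement (hθ : 0 < θ)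
    (hX : IsPoissonProcess P X (stripIntensity θ)) :
    IsPaintbox P (fun ω => rangeComplement (X ω)) where
  isOpen := by
    filter_upwards [ae_isRegular hθ hX] with ω hω
    exact hω.isOpen_rangeComplement
  subset := Eventually.of_forall fun ω => sdiff_subset
  measurable := by
    intro a b
    obtain ⟨T, hTm, -, -, hT⟩ := exists_gridPath hθ hX
    by_cases hab : a ≤ b
    swap
    · have : {ω | Icc a b ⊆ rangeComplement (X ω)} = univ := by
        ext ω; simp [Icc_eq_empty hab]
      rw [this]; exact nullMeasurableSet_univ
    by_cases h : 0 ≤ a ∧ b ≤ 1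
    swap
    · have : {ω | Icc a b ⊆ rangeComplement (X ω)} = ∅ := by
        ext ω
        simp only [mem_ofPred_eq, mem_empty_iff_false, iff_false]
        intro hs
        exact h ⟨(hs (left_mem_Icc.mpr hab)).1.1, (hs (right_mem_Icc.mpr hab)).1.2⟩
      rw [this]; exact nullMeasurableSet_empty
    have hB : MeasurableSet {ω | ∃ r : ℕ, ∀ m k : ℕ, 0 < k →
        T m k ω ∉ Ioo (a - 1 / ((r : ℝ) + 1)) (b + 1 / ((r : ℝ) + 1))} := by
      refine MeasurableSet.congr (s := ⋃ r : ℕ, ⋂ m : ℕ, ⋂ k : ℕ, ⋂ _ : 0 < k,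
        (T m k ⁻¹' Ioo (a - 1 / ((r : ℝ) + 1)) (b + 1 / ((r : ℝ) + 1)))ᶜ) ?_ ?_
      · exact MeasurableSet.iUnion fun r => MeasurableSet.iInter fun m =>
          MeasurableSet.iInter fun k => MeasurableSet.iInter fun _ =>
            (hTm m k measurableSet_Ioo).compl
      · ext ω; simp
    refine hB.nullMeasurableSet.congr ?_
    filter_upwards [hT] with ω hω
    refine propext ?_
    change (∃ r : ℕ, ∀ m k : ℕ, 0 < k →
        T m k ω ∉ Ioo (a - 1 / ((r : ℝ) + 1)) (b + 1 / ((r : ℝ) + 1))) ↔ Icc a b ⊆ _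
    rw [hω.1.Icc_subset_rangeComplement_iff h.1 h.2]
    simp_rw [hω.2]
    exact ⟨fun h _ => h, fun h => h hab⟩

end Paintbox

/-! ### Labelled samples and compositions -/

section Labelling

variable {n : ℕ}

/-- The assignments of `n` labelled balls to the boxes of a composition with the prescribed
occupancy numbers. -/
def labellings (c : Composition n) : Finset (Fin n → Fin c.length) :=
  Finset.univ.filter fun σ => ∀ j, (Finset.univ.filter fun i => σ i = j).card = c.blocksFun j

theorem mem_labellings {c : Composition n} {σ : Fin n → Fin c.length} :
    σ ∈ labellings c ↔ ∀ j, (Finset.univ.filter fun i => σ i = j).card = c.blocksFun j := by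
  simp [labellings]

theorem surjective_of_mem_labellings {c : Composition n} {σ : Fin n → Fin c.length}
    (hσ : σ ∈ labellings c) : Function.Surjective σ := fun j => by
  have h : 0 < (Finset.univ.filter fun i => σ i = j).card := by
    rw [mem_labellings.mp hσ j]; exact c.one_le_blocksFun j
  obtain ⟨i, hi⟩ := Finset.card_pos.mp h
  exact ⟨i, (Finset.mem_filter.mp hi).2⟩

/-- A labelling that is increasing along the sample and constant exactly on its blocks determines
the composition of the sample. -/
theorem sampleComposition_eq {U : Set ℝ} {x : Fin n → ℝ} {c : Composition n}
    {σ : Fin n → Fin c.length} (hσ : σ ∈ labellings c)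
    (hsame : ∀ i i', SameBlock U (x i) (x i') ↔ σ i = σ i')
    (hord : ∀ i i', σ i < σ i' → x i < x i') : sampleComposition U x = c := by
  have hsurj := surjective_of_mem_labellings hσ
  set y : Fin c.length → ℝ := fun j => sInf (x '' {i | σ i = j}) with hy
  have hleft : ∀ i, leftmost U x i = y (σ i) := by
    intro i
    rw [leftmost, hy]
    congr 2
    ext i'
    exact (hsame i i').trans eq_comm
  have hymem : ∀ j, ∃ i, σ i = j ∧ x i = y j := fun j => by
    have hne : (x '' {i | σ i = j}).Nonempty := by
      obtain ⟨i, hi⟩ := hsurj j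
      exact ⟨x i, i, hi, rfl⟩
    obtain ⟨i, hi, h⟩ := hne.csInf_mem (toFinite _)
    exact ⟨i, hi, h⟩
  have hmono : StrictMono y := fun j j' h => by
    obtain ⟨i, hi, hxi⟩ := hymem j
    obtain ⟨i', hi', hxi'⟩ := hymem j'
    rw [← hxi, ← hxi']
    exact hord i i' (by rw [hi, hi']; exact h)
  have himg : Finset.univ.image (leftmost U x) = (List.ofFn y).toFinset := by
    ext a
    simp only [Finset.mem_image, Finset.mem_univ, true_and, List.mem_toFinset, List.mem_ofFn]
    constructor
    · rintro ⟨i, rfl⟩; exact ⟨σ i, (hleft i).symm⟩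
    · rintro ⟨j, rfl⟩
      obtain ⟨i, rfl⟩ := hsurj j
      exact ⟨i, hleft i⟩
  have hsort : (Finset.univ.image (leftmost U x)).sort = List.ofFn y := by
    rw [himg]
    refine (List.toFinset_sort (· ≤ ·) (List.nodup_ofFn.mpr hmono.injective)).mpr ?_
    exact List.pairwise_ofFn.mpr fun i j hij => (hmono hij).le
  refine Composition.ext ?_
  rw [sampleComposition]
  simp only
  rw [hsort, List.map_ofFn, ← c.ofFn_blocksFun]
  congr 1
  funext j
  rw [← mem_labellings.mp hσ j, Function.comp_apply]
  congr 1
  ext i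
  simp [hleft, hmono.injective.eq_iff]

theorem index_mem_labellings (c : Composition n) : c.index ∈ labellings c := by
  refine mem_labellings.mpr fun j => ?_
  have h : (Finset.univ.filter fun i => c.index i = j) = Finset.univ.map (c.embedding j).toEmbedding := by
    ext i
    have := c.mem_range_embedding_iff' (j := i) (i := j)
    simp only [Finset.mem_filter, Finset.mem_univ, true_and, Finset.mem_map,
      RelEmbedding.coe_toEmbedding]
    rw [eq_comm, ← this]; rfl
  rw [h, Finset.card_map, Finset.card_univ, Fintype.card_fin]

/-- There are at least `n! / ∏ λ_j!` labellings: permuting the balls of a fixed labelling gives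
labellings, and `∏ λ_j!` permutations fix it. -/
theorem factorial_le_card_labellings_mul (c : Composition n) :
    n.factorial ≤ (labellings c).card * ∏ j : Fin c.length, (c.blocksFun j).factorial := by
  have hmem : ∀ g : Equiv.Perm (Fin n), c.index ∘ g ∈ labellings c := fun g =>
    mem_labellings.mpr fun j => by
      rw [← mem_labellings.mp (index_mem_labellings c) j]
      exact Finset.card_bij (fun i _ => g i) (fun i hi => by simpa using hi)
        (fun _ _ _ _ h => g.injective h)
        (fun i hi => ⟨g.symm i, by simpa using hi, by simp⟩)
  have hstab : (Finset.univ.filter fun g : Equiv.Perm (Fin n) => c.index ∘ g = c.index).card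
      = ∏ j : Fin c.length, (c.blocksFun j).factorial := by
    rw [← Fintype.card_subtype, DomMulAct.stabilizer_card]
    refine Finset.prod_congr rfl fun j _ => ?_
    rw [Fintype.card_subtype, mem_labellings.mp (index_mem_labellings c) j]
  have h := Finset.card_le_mul_card_image (f := fun g : Equiv.Perm (Fin n) => c.index ∘ g)
    Finset.univ (∏ j : Fin c.length, (c.blocksFun j).factorial) (fun τ hτ => by
      obtain ⟨g₀, -, rfl⟩ := Finset.mem_image.mp hτ
      rw [← hstab]
      refine Finset.card_le_card_of_injOn (fun g => g * g₀⁻¹) (fun g hg => ?_)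
        (fun _ _ _ _ h => mul_right_cancel h)
      have hg' : c.index ∘ g = c.index ∘ g₀ := by simpa using hg
      simp only [Finset.coe_filter, Finset.mem_univ, true_and, mem_ofPred_eq]
      funext i
      have := congrFun hg' (g₀⁻¹ i)
      simpa using this)
  rw [Finset.card_univ, Fintype.card_perm, Fintype.card_fin, mul_comm] at h
  refine h.trans (Nat.mul_le_mul_right _ (Finset.card_le_card fun τ hτ => ?_))
  obtain ⟨g, -, rfl⟩ := Finset.mem_image.mp hτ
  exact hmem g

end Labelling

/-! ### Lower bounds that add up to one -/

section TotalMass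

variable {α : Type*} [MeasurableSpace α] {μ : Measure α} [IsProbabilityMeasure μ]

/-- If lower bounds for the probabilities that a map with finitely many values takes each of its
values add up to `1`, they are the probabilities; it suffices to bound the measure of measurable
sets on which the map takes the value. -/
theorem measure_preimage_eq_of_sum_eq_one {γ : Type*} [Fintype γ] {D : α → γ} {F : γ → Set α}
    (hF : ∀ c, MeasurableSet (F c)) (hD : ∀ c, ∀ᵐ a ∂μ, a ∈ F c → D a = c) {g : γ → ℝ}
    (hsum : ∑ c, g c = 1) (hle : ∀ c, g c ≤ μ.real (F c)) (c : γ) :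
    NullMeasurableSet {a | D a = c} μ ∧ μ {a | D a = c} = ENNReal.ofReal (g c) := by
  have hdisj : Pairwise fun c c' => AEDisjoint μ (F c) (F c') := fun c c' hne => by
    have : ∀ᵐ a ∂μ, a ∉ F c ∩ F c' := by
      filter_upwards [hD c, hD c'] with a h h' ha
      exact hne ((h ha.1).symm.trans (h' ha.2))
    exact measure_eq_zero_iff_ae_notMem.mpr this
  have htot : ∑ c, μ.real (F c) = μ.real (⋃ c, F c) := by
    rw [measureReal_def, measure_iUnion₀ hdisj fun c => (hF c).nullMeasurableSet, tsum_fintype,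
      ENNReal.toReal_sum fun c _ => measure_ne_top _ _]
    rfl
  have hle1 : μ.real (⋃ c, F c) ≤ 1 := measureReal_le_one
  have hge : 1 ≤ ∑ c, μ.real (F c) := by
    rw [← hsum]; exact Finset.sum_le_sum fun c _ => hle c
  have heq : μ.real (F c) = g c := by
    have h := (Finset.sum_eq_sum_iff_of_le (s := Finset.univ) fun c _ => hle c).mp
      (by rw [hsum]; linarith)
    exact (h c (Finset.mem_univ c)).symm
  have hfull : ∀ᵐ a ∂μ, a ∈ ⋃ c, F c := by
    have h1 : μ.real (⋃ c, F c) = 1 := by linarith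
    have h2 : μ (⋃ c, F c) = 1 := by rw [← ofReal_measureReal, h1, ENNReal.ofReal_one]
    exact (mem_ae_iff_prob_eq_one (MeasurableSet.iUnion hF)).mpr h2
  have hae : {a | D a = c} =ᵐ[μ] F c := by
    have hall : ∀ᵐ a ∂μ, ∀ c, a ∈ F c → D a = c := ae_all_iff.mpr hD
    filter_upwards [hfull, hall] with a ha h
    refine propext ⟨fun hc => ?_, fun hc => h c hc⟩
    obtain ⟨c', hc'⟩ := mem_iUnion.mp ha
    have : D a = c := hc
    rw [← this, h c' hc']
    exact hc'
  refine ⟨(hF c).nullMeasurableSet.congr hae.symm, ?_⟩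
  rw [measure_congr hae, ← heq, ofReal_measureReal]

/-- The limit superior of events has at least the limit of their probabilities. -/
theorem le_measureReal_limsup {E : ℕ → Set α} (hE : ∀ m, MeasurableSet (E m)) {a : ℕ → ℝ} {l : ℝ}
    (ha : Tendsto a atTop (𝓝 l)) (hle : ∀ m, a m ≤ μ.real (E m)) :
    l ≤ μ.real (⋂ M : ℕ, ⋃ m : ℕ, ⋃ _ : M ≤ m, E m) := by
  have hanti : Antitone fun M : ℕ => ⋃ m : ℕ, ⋃ _ : M ≤ m, E m := fun M N h =>
    iUnion_mono fun m => iUnion_mono' fun hm => ⟨h.trans hm, le_rfl⟩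
  have ht := tendsto_measure_iInter_atTop (μ := μ)
    (fun M => (MeasurableSet.iUnion fun m => MeasurableSet.iUnion fun _ =>
      hE m).nullMeasurableSet) hanti ⟨0, measure_ne_top _ _⟩
  have ht' := (ENNReal.tendsto_toReal (measure_ne_top μ _)).comp ht
  refine ge_of_tendsto' ht' fun M => ?_
  refine le_of_tendsto ha ?_
  filter_upwards [eventually_ge_atTop M] with m hm
  exact (hle m).trans (measureReal_mono (subset_iUnion₂_of_subset m hm le_rfl)
    (measure_ne_top _ _))

end TotalMass

/-! ### Separation of sample points by the range of the subordinator -/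

section Separation

variable {Ω : Type*} [MeasurableSpace Ω] {P : Measure Ω}

instance : IsProbabilityMeasure unifLaw := ⟨by simp [unifLaw]⟩

instance : NullSingletonClass unifLaw := by unfold unifLaw; infer_instance

theorem ae_sample_notMem {n : ℕ} {B : Set (Ω × ℝ)} (hB : MeasurableSet B)
    (hc : ∀ ω, {y | (ω, y) ∈ B}.Countable) :
    ∀ᵐ z ∂(P.prod (Measure.pi fun _ : Fin n => unifLaw)), ∀ i, (z.1, z.2 i) ∉ B := by
  rw [ae_all_iff]
  intro i
  have hm : MeasurableSet {z : Ω × (Fin n → ℝ) | (z.1, z.2 i) ∈ B} :=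
    (measurable_fst.prodMk ((measurable_pi_apply i).comp measurable_snd)) hB
  rw [ae_iff]
  simp only [not_not]
  rw [Measure.measure_prod_null hm]
  refine Eventually.of_forall fun ω => ?_
  have h0 : unifLaw {y | (ω, y) ∈ B} = 0 := (hc ω).measure_zero _
  exact (Measure.quasiMeasurePreserving_eval (fun _ : Fin n => unifLaw) i).preimage_null h0

/-- A point of a set of reals whose right (or left) neighbourhood misses the set is an endpoint of
a gap, and there are countably many of those. Hence a sample of uniform points almost surely avoids
them, and two sample points are separated by a point of a random countable set as soon as the closed
interval between them meets the closure of that set. No information about the Lebesgue measure of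
the closure is needed. -/
theorem ae_exists_mem_Ioo_of_mem_closure {ι : Type*} [Countable ι] {G : ι → Ω → ℝ}
    (hG : ∀ i, Measurable (G i)) (n : ℕ) :
    ∀ᵐ z ∂(P.prod (Measure.pi fun _ : Fin n => unifLaw)), ∀ i i', z.2 i < z.2 i' →
      (∃ y ∈ Icc (z.2 i) (z.2 i'), y ∈ closure (range fun a => G a z.1)) →
      ∃ a, G a z.1 ∈ Ioo (z.2 i) (z.2 i') := by
  -- `B₁` and `B₂` collect the points of the closure that are isolated from the right and from the
  -- left; rational bounds make them measurable in `Ω × ℝ`, as Fubini's theorem requires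
  set B₁ : Set (Ω × ℝ) := {p | (∀ r : ℕ, ∃ a, |G a p.1 - p.2| < 1 / ((r : ℝ) + 1)) ∧
    ∃ q : ℚ, p.2 < q ∧ ∀ a, G a p.1 ∉ Ioo p.2 (q : ℝ)} with hB₁
  set B₂ : Set (Ω × ℝ) := {p | (∀ r : ℕ, ∃ a, |G a p.1 - p.2| < 1 / ((r : ℝ) + 1)) ∧
    ∃ q : ℚ, (q : ℝ) < p.2 ∧ ∀ a, G a p.1 ∉ Ioo (q : ℝ) p.2} with hB₂
  have hGm : ∀ a, Measurable fun p : Ω × ℝ => G a p.1 := fun a => (hG a).comp measurable_fst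
  have hcm : MeasurableSet {p : Ω × ℝ | ∀ r : ℕ, ∃ a, |G a p.1 - p.2| < 1 / ((r : ℝ) + 1)} := by
    simp only [ofPred_forall, ofPred_exists]
    refine MeasurableSet.iInter fun r => MeasurableSet.iUnion fun a => ?_
    exact measurableSet_lt (((hGm a).sub measurable_snd).abs) measurable_const
  have hm₁ : MeasurableSet B₁ := by
    refine hcm.inter
      (s₂ := {p : Ω × ℝ | ∃ q : ℚ, p.2 < q ∧ ∀ a, G a p.1 ∉ Ioo p.2 (q : ℝ)}) ?_
    simp only [ofPred_forall, ofPred_exists, ofPred_and]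
    refine MeasurableSet.iUnion fun q => (measurableSet_lt measurable_snd measurable_const).inter
      (MeasurableSet.iInter fun a => ?_)
    exact ((measurableSet_lt measurable_snd (hGm a)).inter
      (measurableSet_lt (hGm a) measurable_const)).compl
  have hm₂ : MeasurableSet B₂ := by
    refine hcm.inter
      (s₂ := {p : Ω × ℝ | ∃ q : ℚ, (q : ℝ) < p.2 ∧ ∀ a, G a p.1 ∉ Ioo (q : ℝ) p.2}) ?_
    simp only [ofPred_forall, ofPred_exists, ofPred_and]
    refine MeasurableSet.iUnion fun q => (measurableSet_lt measurable_const measurable_snd).inter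
      (MeasurableSet.iInter fun a => ?_)
    exact ((measurableSet_lt measurable_const (hGm a)).inter
      (measurableSet_lt (hGm a) measurable_snd)).compl
  have hclos : ∀ ω y, (∀ r : ℕ, ∃ a, |G a ω - y| < 1 / ((r : ℝ) + 1)) ↔
      y ∈ closure (range fun a => G a ω) := by
    intro ω y
    rw [Metric.mem_closure_range_iff]
    constructor
    · intro h ε hε
      obtain ⟨r, hr⟩ := exists_nat_one_div_lt hε
      obtain ⟨a, ha⟩ := h r
      exact ⟨a, by rw [dist_comm, Real.dist_eq]; exact ha.trans hr⟩
    · intro h r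
      obtain ⟨a, ha⟩ := h (1 / ((r : ℝ) + 1)) (by positivity)
      exact ⟨a, by rwa [dist_comm, Real.dist_eq] at ha⟩
  have hc₁ : ∀ ω, {y | (ω, y) ∈ B₁}.Countable := by
    intro ω
    refine (countable_setOfPred_isolated_right_within
      (s := closure (range fun a => G a ω))).mono ?_
    rintro y ⟨h1, q, hq, h2⟩
    refine ⟨(hclos ω y).mp h1, ?_⟩
    rw [← empty_mem_iff_bot, mem_nhdsWithin]
    refine ⟨Iio q, isOpen_Iio, hq, ?_⟩
    rintro x ⟨hx1, hx2, hx3⟩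
    obtain ⟨_, hx, a, rfl⟩ := mem_closure_iff.mp hx2 (Ioo y q) isOpen_Ioo ⟨hx3, hx1⟩
    exact (h2 a hx).elim
  have hc₂ : ∀ ω, {y | (ω, y) ∈ B₂}.Countable := by
    intro ω
    refine (countable_setOfPred_isolated_left_within
      (s := closure (range fun a => G a ω))).mono ?_
    rintro y ⟨h1, q, hq, h2⟩
    refine ⟨(hclos ω y).mp h1, ?_⟩
    rw [← empty_mem_iff_bot, mem_nhdsWithin]
    refine ⟨Ioi q, isOpen_Ioi, hq, ?_⟩
    rintro x ⟨hx1, hx2, hx3⟩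
    obtain ⟨_, hx, a, rfl⟩ := mem_closure_iff.mp hx2 (Ioo q y) isOpen_Ioo ⟨hx1, hx3⟩
    exact (h2 a hx).elim
  filter_upwards [ae_sample_notMem (n := n) (P := P) hm₁ hc₁,
    ae_sample_notMem (n := n) (P := P) hm₂ hc₂] with z h₁ h₂ i i' hlt ⟨y, hy, hyc⟩
  by_contra hno
  push Not at hno
  rcases hy.1.eq_or_lt with h | h
  · obtain ⟨q, hq1, hq2⟩ := exists_rat_btwn hlt
    exact h₁ i ⟨(hclos _ _).mpr (by rw [h]; exact hyc), q, hq1,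
      fun a ha => hno a ⟨ha.1, ha.2.trans hq2⟩⟩
  · rcases hy.2.eq_or_lt with h' | h'
    · obtain ⟨q, hq1, hq2⟩ := exists_rat_btwn hlt
      exact h₂ i' ⟨(hclos _ _).mpr (by rw [← h']; exact hyc), q, hq2,
        fun a ha => hno a ⟨hq1.trans ha.1, ha.2⟩⟩
    · obtain ⟨_, hx, a, rfl⟩ := mem_closure_iff.mp hyc _ isOpen_Ioo
        (show y ∈ Ioo (z.2 i) (z.2 i') from ⟨h, h'⟩)
      exact hno a hx

theorem SameBlock.symm {U : Set ℝ} {x y : ℝ} (h : SameBlock U x y) : SameBlock U y x := by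
  rcases h with h | h
  · exact Or.inl h.symm
  · exact Or.inr (by rwa [uIcc_comm])

/-- The samples whose point `i` lies in the cell `(S_{k_j/(m+1)}, S_{(k_j+1)/(m+1)}]` with
`j = σ i`, for all `i`; here `T` is the sequence of values of the path at the grid times. -/
def cellEvent {n l : ℕ} (T : ℕ → Ω → ℝ) (σ : Fin n → Fin l) (k : Fin l → ℕ) :
    Set (Ω × (Fin n → ℝ)) :=
  {z | ∀ i, z.2 i ∈ Ioc (T (k (σ i)) z.1) (T (k (σ i) + 1) z.1)}

/-- If all sample points in different blocks are separated by the path, then on fine grids the cells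
of the grid carry the composition of the sample. -/
theorem sampleComposition_eq_of_frequently {X : Set (ℝ × ℝ)} (hX : IsRegular X) {n : ℕ}
    {x : Fin n → ℝ} {c : Composition n}
    (hsep : ∀ i i', x i < x i' → ¬ SameBlock (rangeComplement X) (x i) (x i') →
      ∃ t > 0, subordinator X t ∈ Ioo (x i) (x i'))
    (hfreq : ∃ᶠ m : ℕ in atTop, ∃ σ ∈ labellings c, ∃ k : Fin c.length → ℕ, StrictMono k ∧
      ∀ i, x i ∈ Ioc (subordinator X (k (σ i) / ((m : ℝ) + 1)))
        (subordinator X ((k (σ i) + 1 : ℕ) / ((m : ℝ) + 1)))) :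
    sampleComposition (rangeComplement X) x = c := by
  have hev : ∀ᶠ m : ℕ in atTop, ∀ i i', x i < x i' →
      ¬ SameBlock (rangeComplement X) (x i) (x i') →
      ∃ k : ℕ, subordinator X (k / ((m : ℝ) + 1)) ∈ Ioo (x i) (x i') := by
    rw [eventually_all]; intro i
    rw [eventually_all]; intro i'
    by_cases h : x i < x i' ∧ ¬ SameBlock (rangeComplement X) (x i) (x i')
    · obtain ⟨t, ht, hmem⟩ := hsep i i' h.1 h.2
      filter_upwards [hX.eventually_exists_grid (le_of_lt ht) (sub_pos.mpr hmem.2)] with m hm _ _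
      obtain ⟨k, h1, h2⟩ := hm
      exact ⟨k, hmem.1.trans_le (hX.monotone h1), by linarith⟩
    · exact Eventually.of_forall fun m h1 h2 => (h ⟨h1, h2⟩).elim
  obtain ⟨m, ⟨σ, hσ, k, hk, hcell⟩, hm⟩ := (hfreq.and_eventually hev).exists
  have hgrid : ∀ a b : ℕ, a ≤ b →
      subordinator X (a / ((m : ℝ) + 1)) ≤ subordinator X (b / ((m : ℝ) + 1)) := fun a b h =>
    hX.monotone (by gcongr)
  -- the right end of the cell of the earlier point is a value of the path between the two points
  have hcut : ∀ i i', σ i < σ i' →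
      subordinator X ((k (σ i) + 1 : ℕ) / ((m : ℝ) + 1)) ∈ Ico (x i) (x i') := fun i i' h =>
    ⟨(hcell i).2, (hgrid _ _ (hk h)).trans_lt (hcell i').1⟩
  have hord : ∀ i i', σ i < σ i' → x i < x i' := fun i i' h =>
    (hcut i i' h).1.trans_lt (hcut i i' h).2
  have hnot : ∀ i i', σ i < σ i' → ¬ SameBlock (rangeComplement X) (x i) (x i') := by
    rintro i i' h (hs | hs)
    · exact (hord i i' h).ne hs
    · rw [uIcc_of_le (hord i i' h).le] at hs
      refine (hs (Ico_subset_Icc_self (hcut i i' h))).2 (subset_closure (mem_image_of_mem _ ?_))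
      rw [mem_Ioi]; positivity
  have hsame : ∀ i i', σ i = σ i' → x i < x i' →
      SameBlock (rangeComplement X) (x i) (x i') := by
    intro i i' h hlt
    by_contra hs
    obtain ⟨a, ha⟩ := hm i i' hlt hs
    rcases le_or_gt a (k (σ i)) with hle | hgt
    · linarith [hgrid _ _ hle, (hcell i).1, ha.1]
    · have h2 := (hcell i').2
      rw [← h] at h2
      linarith [hgrid _ _ (Nat.succ_le_of_lt hgt), ha.2]
  refine sampleComposition_eq hσ (fun i i' => ⟨fun hs => ?_, fun h => ?_⟩) hord
  · rcases lt_trichotomy (σ i) (σ i') with h | h | h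
    · exact (hnot i i' h hs).elim
    · exact h
    · exact (hnot i' i h hs.symm).elim
  · rcases lt_trichotomy (x i) (x i') with hx | hx | hx
    · exact hsame i i' h hx
    · exact Or.inl hx
    · exact (hsame i' i h.symm hx).symm

theorem ae_sampleComposition_eq {X : Ω → Set (ℝ × ℝ)} {T : ℕ → ℕ → Ω → ℝ}
    (hTm : ∀ m k, Measurable (T m k))
    (hT : ∀ᵐ ω ∂P, IsRegular (X ω) ∧
        ∀ m k : ℕ, T m k ω = subordinator (X ω) (k / ((m : ℝ) + 1)))
    {n : ℕ} (c : Composition n) :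
    ∀ᵐ z ∂(P.prod (Measure.pi fun _ : Fin n => unifLaw)),
      (∃ᶠ m : ℕ in atTop, ∃ σ ∈ labellings c, ∃ k : Fin c.length → ℕ, StrictMono k ∧
        z ∈ cellEvent (T m) σ k) →
      sampleComposition (rangeComplement (X z.1)) z.2 = c := by
  have hI : ∀ᵐ x ∂(Measure.pi fun _ : Fin n => unifLaw), ∀ i, x i ∈ Icc (0 : ℝ) 1 := by
    rw [ae_all_iff]; intro i
    exact (Measure.quasiMeasurePreserving_eval (fun _ : Fin n => unifLaw) i).ae
      (ae_restrict_mem measurableSet_Icc)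
  filter_upwards [Measure.quasiMeasurePreserving_fst.ae hT,
    Measure.quasiMeasurePreserving_snd.ae hI,
    ae_exists_mem_Ioo_of_mem_closure (P := P) (G := fun a : ℕ × ℕ => T a.1 (a.2 + 1))
      (fun a => hTm _ _) n] with z hz hx hsep hfreq
  obtain ⟨hreg, hval⟩ := hz
  refine sampleComposition_eq_of_frequently hreg (fun i i' hlt hns => ?_) (hfreq.mono ?_)
  · have hcl : closure (subordinator (X z.1) '' Ioi 0)
        ⊆ closure (range fun a : ℕ × ℕ => T a.1 (a.2 + 1) z.1) := by
      refine closure_minimal ?_ isClosed_closure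
      rintro _ ⟨t, ht, rfl⟩
      rw [Metric.mem_closure_range_iff]
      intro ε hε
      obtain ⟨m, k, hk, h⟩ := hreg.exists_grid_mem_Ioo ht
        (a := subordinator (X z.1) t - ε) (b := subordinator (X z.1) t + ε)
        ⟨by linarith, by linarith⟩
      refine ⟨(m, k - 1), ?_⟩
      simp only [hval, Nat.sub_add_cancel hk]
      rw [dist_comm, Real.dist_eq, abs_lt]
      constructor <;> linarith [h.1, h.2]
    have hy : ∃ y ∈ Icc (z.2 i) (z.2 i'), y ∉ rangeComplement (X z.1) := by
      by_contra h
      push Not at h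
      exact hns (Or.inr (by rw [uIcc_of_le hlt.le]; exact h))
    obtain ⟨y, hyI, hyU⟩ := hy
    have hyc : y ∈ closure (subordinator (X z.1) '' Ioi 0) := by
      by_contra h
      exact hyU ⟨⟨(hx i).1.trans hyI.1, hyI.2.trans (hx i').2⟩, h⟩
    obtain ⟨a, ha⟩ := hsep i i' hlt ⟨y, hyI, hcl hyc⟩
    rw [hval] at ha
    refine ⟨_, ?_, ha⟩
    positivity
  · rintro m ⟨σ, hσ, k, hk, hcell⟩
    refine ⟨σ, hσ, k, hk, fun i => ?_⟩
    have := hcell i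
    rwa [hval, hval] at this

end Separation

/-! ### Positions of cells on a grid -/

section CellIndex

/-- The sum of the parts after the `j`-th one. -/
def laterSum {n : ℕ} (c : Composition n) (j : Fin c.length) : ℕ :=
  ∑ i ∈ Finset.Ioi j, c.blocksFun i

theorem tailSum_eq_add {n : ℕ} (c : Composition n) (j : Fin c.length) :
    tailSum c j = c.blocksFun j + laterSum c j := by
  rw [tailSum, laterSum, ← Finset.Ioi_insert, Finset.sum_insert (by simp)]

/-- The first grid index after the cell of the `(j-1)`-st block, when the cell of the `i`-th block
is preceded by a gap of `d i` cells without sample points. -/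
def startIndex {l : ℕ} (d : Fin l → ℕ) (j : ℕ) : ℕ :=
  ∑ i ∈ Finset.univ.filter (fun i : Fin l => (i : ℕ) < j), (d i + 1)

/-- The grid index of the cell of the `j`-th block. -/
def cellIndex {l : ℕ} (d : Fin l → ℕ) (j : Fin l) : ℕ := startIndex d j + d j

variable {l : ℕ}

theorem startIndex_zero (d : Fin l → ℕ) : startIndex d 0 = 0 := by simp [startIndex]

theorem filter_val_lt_succ (j : Fin l) :
    Finset.univ.filter (fun i : Fin l => (i : ℕ) < (j : ℕ) + 1)
      = insert j (Finset.univ.filter fun i : Fin l => (i : ℕ) < j) := by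
  ext i
  simp only [Finset.mem_filter, Finset.mem_univ, true_and, Finset.mem_insert, Fin.ext_iff]
  omega

theorem startIndex_succ (d : Fin l → ℕ) (j : Fin l) :
    startIndex d (j + 1) = cellIndex d j + 1 := by
  rw [startIndex, filter_val_lt_succ, Finset.sum_insert (by simp), cellIndex, startIndex]
  ring

theorem monotone_startIndex (d : Fin l → ℕ) : Monotone (startIndex d) := fun _ _ h =>
  Finset.sum_le_sum_of_subset fun i hi => by
    simp only [Finset.mem_filter, Finset.mem_univ, true_and] at hi ⊢
    omega

theorem strictMono_cellIndex (d : Fin l → ℕ) : StrictMono (cellIndex d) := fun i j h => by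
  have h1 := monotone_startIndex d (show (i : ℕ) + 1 ≤ j from h)
  rw [startIndex_succ] at h1
  exact (Nat.lt_of_succ_le h1).trans_le (Nat.le_add_right _ _)

theorem cellIndex_injective : Function.Injective (cellIndex (l := l)) := fun d d' h => by
  have hs : ∀ j : Fin l, startIndex d j = startIndex d' j := by
    rintro ⟨j, hj⟩
    cases j with
    | zero => simp [startIndex_zero]
    | succ j =>
      have h1 := startIndex_succ d ⟨j, by omega⟩
      have h2 := startIndex_succ d' ⟨j, by omega⟩
      rw [h] at h1
      exact h1.trans h2.symm
  funext j
  have := congrFun h j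
  rw [cellIndex, cellIndex, hs j] at this
  omega

end CellIndex

/-! ### The probability of a cell event -/

section CellProbability

variable {Ω : Type*} [MeasurableSpace Ω] {P : Measure Ω} {T : ℕ → Ω → ℝ} {n : ℕ}

theorem measurableSet_cellEvent {l : ℕ} (hT : ∀ k, Measurable (T k)) (σ : Fin n → Fin l)
    (k : Fin l → ℕ) : MeasurableSet (cellEvent T σ k) := by
  simp only [cellEvent, ofPred_forall]
  refine MeasurableSet.iInter fun i => ?_
  have h : Measurable fun z : Ω × (Fin n → ℝ) => z.2 i :=
    (measurable_pi_apply i).comp measurable_snd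
  exact (measurableSet_lt ((hT _).comp measurable_fst) h).inter
    (measurableSet_le h ((hT _).comp measurable_fst))

omit [MeasurableSpace Ω] in
/-- Different labellings or different cells give disjoint events, because the cells of a grid are
disjoint and a surjective labelling is recovered from the order of its cells. -/
theorem disjoint_cellEvent (hmono : ∀ ω, Monotone fun k => T k ω) {c : Composition n}
    {σ σ' : Fin n → Fin c.length} (hσ : σ ∈ labellings c) (hσ' : σ' ∈ labellings c)
    {d d' : Fin c.length → ℕ} (hne : (σ, d) ≠ (σ', d')) :
    Disjoint (cellEvent T σ (cellIndex d)) (cellEvent T σ' (cellIndex d')) := by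
  refine Set.disjoint_left.mpr fun z hz hz' => hne ?_
  have hk : cellIndex d ∘ σ = cellIndex d' ∘ σ' := by
    funext i
    by_contra h
    exact Set.disjoint_left.mp ((hmono z.1).pairwise_disjoint_on_Ioc_succ h) (hz i) (hz' i)
  have hr : range (cellIndex d) = range (cellIndex d') := by
    rw [← (surjective_of_mem_labellings hσ).range_comp,
      ← (surjective_of_mem_labellings hσ').range_comp, hk]
  have hdd : cellIndex d = cellIndex d' :=
    (StrictMono.range_inj (strictMono_cellIndex d) (strictMono_cellIndex d')).mp hr
  obtain rfl := cellIndex_injective hdd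
  rw [Prod.mk.injEq]
  refine ⟨funext fun i => (strictMono_cellIndex d).injective (congrFun hk i), rfl⟩

theorem unifLaw_Ioc {a b : ℝ} (ha : 0 ≤ a) (hb : b ≤ 1) :
    unifLaw (Ioc a b) = ENNReal.ofReal (b - a) := by
  have h : Ioc a b ∩ Icc 0 1 = Ioc a b :=
    inter_eq_left.mpr fun x hx => ⟨ha.trans hx.1.le, hx.2.trans hb⟩
  rw [unifLaw, Measure.restrict_apply measurableSet_Ioc, h, Real.volume_Ioc]

theorem measureReal_cellEvent [IsProbabilityMeasure P] (hT : ∀ k, Measurable (T k))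
    (hmono : ∀ ω, Monotone fun k => T k ω) (h01 : ∀ k ω, T k ω ∈ Icc (0 : ℝ) 1)
    {c : Composition n} {σ : Fin n → Fin c.length} (hσ : σ ∈ labellings c)
    (k : Fin c.length → ℕ) :
    (P.prod (Measure.pi fun _ : Fin n => unifLaw)).real (cellEvent T σ k)
      = ∫ ω, ∏ j, (T (k j + 1) ω - T (k j) ω) ^ c.blocksFun j ∂P := by
  have hnn : ∀ ω j, 0 ≤ T (k j + 1) ω - T (k j) ω := fun ω j =>
    sub_nonneg.mpr (hmono ω (Nat.le_succ _))
  have hsec : ∀ ω, (Measure.pi fun _ : Fin n => unifLaw) (Prod.mk ω ⁻¹' cellEvent T σ k)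
      = ENNReal.ofReal (∏ j, (T (k j + 1) ω - T (k j) ω) ^ c.blocksFun j) := by
    intro ω
    have hpre : Prod.mk ω ⁻¹' cellEvent T σ k
        = univ.pi fun i => Ioc (T (k (σ i)) ω) (T (k (σ i) + 1) ω) := by
      ext x; simp [cellEvent]
    rw [hpre, Measure.pi_pi]
    simp_rw [unifLaw_Ioc (h01 _ ω).1 (h01 _ ω).2]
    rw [← ENNReal.ofReal_prod_of_nonneg fun i _ => hnn ω (σ i)]
    congr 1
    rw [← Finset.prod_fiberwise Finset.univ σ]
    refine Finset.prod_congr rfl fun j _ => ?_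
    rw [← mem_labellings.mp hσ j, ← Finset.prod_const]
    refine Finset.prod_congr rfl fun i hi => ?_
    rw [(Finset.mem_filter.mp hi).2]
  have hm : Measurable fun ω => ∏ j, (T (k j + 1) ω - T (k j) ω) ^ c.blocksFun j :=
    Finset.measurable_prod _ fun j _ => ((hT _).sub (hT _)).pow_const _
  rw [measureReal_def, Measure.prod_apply (measurableSet_cellEvent hT σ k)]
  simp_rw [hsec]
  rw [integral_eq_lintegral_of_nonneg_ae
    (Eventually.of_forall fun ω => Finset.prod_nonneg fun j _ => pow_nonneg (hnn ω j) _)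
    hm.aestronglyMeasurable]

end CellProbability

/-! ### Mean products of cell lengths -/

section CellMean

variable {X : Set (ℝ × ℝ)} {l : ℕ}

/-- The time interval of the gap before the cell of the `j`-th block, on the grid of mesh `h`. -/
def gapInterval (h : ℝ) (d : Fin l → ℕ) (j : Fin l) : Set ℝ :=
  Ioc (startIndex d j * h) (cellIndex d j * h)

/-- The time interval of the cell of the `j`-th block, on the grid of mesh `h`. -/
def cellInterval (h : ℝ) (d : Fin l → ℕ) (j : Fin l) : Set ℝ :=
  Ioc (cellIndex d j * h) (startIndex d (j + 1) * h)

theorem survival_startIndex (hX : IsRegular X) {h : ℝ} (hh : 0 ≤ h) (d : Fin l → ℕ) {j : ℕ}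
    (hj : j ≤ l) :
    survival X (Iic (startIndex d j * h))
      = ∏ i ∈ Finset.univ.filter (fun i : Fin l => (i : ℕ) < j),
        survival X (gapInterval h d i) * survival X (cellInterval h d i) := by
  induction j with
  | zero =>
    have h0 := hX.subordinator_eq 0
    rw [hX.subordinator_zero] at h0
    simp [startIndex_zero]
    linarith
  | succ j ih =>
    set i : Fin l := ⟨j, hj⟩
    have h1 : (startIndex d j : ℝ) * h ≤ cellIndex d i * h := by
      gcongr; exact Nat.le_add_right _ _
    have h2 : (cellIndex d i : ℝ) * h ≤ startIndex d (i + 1) * h := by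
      gcongr; rw [startIndex_succ]; omega
    rw [show j + 1 = (i : ℕ) + 1 from rfl, filter_val_lt_succ, Finset.prod_insert (by simp),
      survival_Iic_mul_Ioc X h2, survival_Iic_mul_Ioc X h1, ih (by omega), cellInterval,
      gapInterval]
    ring

theorem prod_prod_lt_pow (c : Composition l) (y : Fin c.length → ℝ) :
    ∏ j : Fin c.length, (∏ i ∈ Finset.univ.filter (fun i : Fin c.length => (i : ℕ) < j), y i) ^ c.blocksFun j
      = ∏ i, y i ^ laterSum c i := by
  simp_rw [← Finset.prod_pow, laterSum, ← Finset.prod_pow_eq_pow_sum]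
  refine Finset.prod_comm' fun i j => ?_
  simp only [Finset.mem_filter, Finset.mem_univ, true_and, and_true, Finset.mem_Ioi, Fin.lt_def]

/-- The product of the cell lengths in terms of the survival factors of gaps and cells. A later
block contributes its size to the exponents of all earlier gaps and cells. -/
theorem prod_cell_length_pow (hX : IsRegular X) {h : ℝ} (hh : 0 ≤ h) {n : ℕ} (c : Composition n)
    (d : Fin c.length → ℕ) :
    ∏ j : Fin c.length, (subordinator X (startIndex d (j + 1) * h)
        - subordinator X (cellIndex d j * h)) ^ c.blocksFun j
      = (∏ j, survival X (gapInterval h d j) ^ tailSum c j) *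
        ∏ j, (1 - survival X (cellInterval h d j)) ^ c.blocksFun j *
          survival X (cellInterval h d j) ^ laterSum c j := by
  have hlen : ∀ j : Fin c.length, subordinator X (startIndex d (j + 1) * h)
        - subordinator X (cellIndex d j * h)
      = (∏ i ∈ Finset.univ.filter (fun i : Fin c.length => (i : ℕ) < j),
          survival X (gapInterval h d i) * survival X (cellInterval h d i)) *
        (survival X (gapInterval h d j) * (1 - survival X (cellInterval h d j))) := by
    intro j
    have h1 : (startIndex d j : ℝ) * h ≤ cellIndex d j * h := by
      gcongr; exact Nat.le_add_right _ _
    have h2 : (cellIndex d j : ℝ) * h ≤ startIndex d (j + 1) * h := by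
      gcongr; rw [startIndex_succ]; omega
    rw [hX.subordinator_eq, hX.subordinator_eq, survival_Iic_mul_Ioc X h2,
      survival_Iic_mul_Ioc X h1, survival_startIndex hX hh d j.2.le, cellInterval, gapInterval]
    ring
  simp_rw [hlen, mul_pow, Finset.prod_mul_distrib, tailSum_eq_add, pow_add]
  have := prod_prod_lt_pow c fun i =>
    survival X (gapInterval h d i) * survival X (cellInterval h d i)
  simp_rw [Finset.prod_mul_distrib, mul_pow, Finset.prod_mul_distrib] at this ⊢
  rw [this]
  ring

variable {θ : ℝ} {Ω : Type*} [MeasurableSpace Ω] {P : Measure Ω} [IsProbabilityMeasure P]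
  {X : Ω → Set (ℝ × ℝ)}

theorem integral_prod_cell_length_pow (hθ : 0 < θ)
    (hX : IsPoissonProcess P X (stripIntensity θ)) {h : ℝ} (hh : 0 ≤ h) {n : ℕ}
    (c : Composition n) (d : Fin c.length → ℕ) :
    ∫ ω, ∏ j : Fin c.length, (subordinator (X ω) (startIndex d (j + 1) * h)
        - subordinator (X ω) (cellIndex d j * h)) ^ c.blocksFun j ∂P
      = ∏ j, Real.exp (-(h * genHarmonic θ (tailSum c j))) ^ d j *
        polyMean θ h ((1 - Polynomial.X) ^ c.blocksFun j * Polynomial.X ^ laterSum c j) := by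
  have hle1 : ∀ j : Fin c.length, (startIndex d j : ℝ) * h ≤ cellIndex d j * h := fun j => by
    gcongr; exact Nat.le_add_right _ _
  have hle2 : ∀ j : Fin c.length, (cellIndex d j : ℝ) * h ≤ startIndex d (j + 1) * h := fun j => by
    gcongr; rw [startIndex_succ]; omega
  have hmono : Monotone fun j : ℕ => (startIndex d j : ℝ) * h := fun i j hij =>
    mul_le_mul_of_nonneg_right (by exact_mod_cast monotone_startIndex d hij) hh
  have hdisj : ∀ i j : Fin c.length, i ≠ j →
      Disjoint (Ioc ((startIndex d i : ℝ) * h) (startIndex d (i + 1) * h))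
        (Ioc ((startIndex d j : ℝ) * h) (startIndex d (j + 1) * h)) := fun i j hij =>
    hmono.pairwise_disjoint_on_Ioc_succ (Fin.val_injective.ne hij)
  have hsubA : ∀ j, gapInterval h d j
      ⊆ Ioc ((startIndex d j : ℝ) * h) (startIndex d (j + 1) * h) := fun j =>
    Ioc_subset_Ioc_right (hle2 j)
  have hsubB : ∀ j, cellInterval h d j
      ⊆ Ioc ((startIndex d j : ℝ) * h) (startIndex d (j + 1) * h) := fun j =>
    Ioc_subset_Ioc_left (hle1 j)
  have hAB : ∀ j, Disjoint (gapInterval h d j) (cellInterval h d j) := fun j =>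
    Ioc_disjoint_Ioc_of_le le_rfl
  -- the gaps and the cells together form a disjoint family of time sets
  set J : Fin c.length ⊕ Fin c.length → Set ℝ := Sum.elim (gapInterval h d) (cellInterval h d)
  set p : Fin c.length ⊕ Fin c.length → Polynomial ℝ :=
    Sum.elim (fun j => Polynomial.X ^ tailSum c j)
      (fun j => (1 - Polynomial.X) ^ c.blocksFun j * Polynomial.X ^ laterSum c j)
  have hJd : Pairwise fun i j => Disjoint (J i) (J j) := by
    rintro (i | i) (j | j) hne
    · exact (hdisj i j fun h => hne (congrArg _ h)).mono (hsubA i) (hsubA j)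
    · by_cases hij : i = j
      · subst hij; exact hAB i
      · exact (hdisj i j hij).mono (hsubA i) (hsubB j)
    · by_cases hij : i = j
      · subst hij; exact (hAB i).symm
      · exact (hdisj i j hij).mono (hsubB i) (hsubA j)
    · exact (hdisj i j fun h => hne (congrArg _ h)).mono (hsubB i) (hsubB j)
  have hmean := integral_prod_polynomial_survival hθ hX (J := J)
    (by rintro (i | i) <;> exact measurableSet_Ioc)
    (by rintro (i | i) <;> exact volume_Ici_inter_Ioc_ne_top _ _) hJd p
  have hlenA : ∀ j, timeLength (gapInterval h d j) = d j * h := fun j => by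
    rw [gapInterval, timeLength_Ioc (by positivity) (hle1 j), cellIndex]
    push_cast; ring
  have hlenB : ∀ j, timeLength (cellInterval h d j) = h := fun j => by
    rw [cellInterval, timeLength_Ioc (by positivity) (hle2 j), startIndex_succ]
    push_cast; ring
  have hcongr : (fun ω => ∏ j : Fin c.length, (subordinator (X ω) (startIndex d (j + 1) * h)
        - subordinator (X ω) (cellIndex d j * h)) ^ c.blocksFun j)
      =ᵐ[P] fun ω => ∏ i, (p i).eval (survival (X ω) (J i)) := by
    filter_upwards [ae_isRegular hθ hX] with ω hω
    rw [prod_cell_length_pow hω hh, Fintype.prod_sum_type]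
    simp [J, p]
  rw [integral_congr_ae hcongr, hmean, Fintype.prod_sum_type, ← Finset.prod_mul_distrib]
  refine Finset.prod_congr rfl fun j _ => ?_
  simp only [J, p, Sum.elim_inl, Sum.elim_inr, hlenA, hlenB, polyMean_X_pow]
  rw [← Real.exp_nat_mul]
  congr 2
  ring

end CellMean

/-! ### The sampling formula -/

section Sampling

variable {θ : ℝ}

theorem prod_ascPochhammer_laterSum (hθ : 0 < θ) {n : ℕ} (c : Composition n) :
    ∏ j, (ascPochhammer ℝ (laterSum c j)).eval θ / (ascPochhammer ℝ (tailSum c j)).eval θ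
      = 1 / (ascPochhammer ℝ n).eval θ := by
  have hl : ∀ l : List ℕ, blockProd (fun a s => (ascPochhammer ℝ (s - a)).eval θ /
      (ascPochhammer ℝ s).eval θ) l = 1 / (ascPochhammer ℝ l.sum).eval θ := by
    intro l
    induction l with
    | nil => simp [blockProd]
    | cons a l ih =>
      rw [blockProd, ih, Nat.add_sub_cancel_left, List.sum_cons]
      have := ascPochhammer_pos l.sum θ hθ
      field_simp
  have h := hl c.blocks
  rw [c.blocks_sum, ← prod_blocksFun_tailSum c] at h
  rw [← h]
  refine Finset.prod_congr rfl fun j _ => ?_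
  rw [tailSum_eq_add, Nat.add_sub_cancel_left]

/-- The limit of the probability bounds on fine grids dominates the sampling formula. -/
theorem gFormula_le_card_mul_prod (hθ : 0 < θ) {n : ℕ} (c : Composition n) :
    gFormula θ n c ≤ (labellings c).card * ∏ j, ((c.blocksFun j - 1).factorial *
      (ascPochhammer ℝ (laterSum c j)).eval θ / (ascPochhammer ℝ (tailSum c j)).eval θ /
      genHarmonic θ (tailSum c j)) := by
  have hcard : (n.factorial : ℝ)
      ≤ (labellings c).card * ∏ j : Fin c.length, ((c.blocksFun j).factorial : ℝ) := by
    exact_mod_cast factorial_le_card_labellings_mul c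
  have hfac : ∀ j, ((c.blocksFun j).factorial : ℝ)
      = c.blocksFun j * (c.blocksFun j - 1).factorial := fun j => by
    exact_mod_cast (Nat.mul_factorial_pred (Nat.one_le_iff_ne_zero.mp (c.one_le_blocksFun j))).symm
  have hb : ∀ j, (0 : ℝ) < c.blocksFun j := fun j => by exact_mod_cast c.one_le_blocksFun j
  have hH : ∀ j, 0 < genHarmonic θ (tailSum c j) := fun j =>
    genHarmonic_pos hθ (by rw [tailSum_eq_add]; have := c.one_le_blocksFun j; omega)
  have hsplit : ∏ j, ((c.blocksFun j - 1).factorial *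
      (ascPochhammer ℝ (laterSum c j)).eval θ / (ascPochhammer ℝ (tailSum c j)).eval θ /
      genHarmonic θ (tailSum c j))
      = (∏ j : Fin c.length, ((c.blocksFun j).factorial : ℝ)) *
        (1 / (ascPochhammer ℝ n).eval θ) *
        ∏ j, 1 / ((c.blocksFun j : ℝ) * genHarmonic θ (tailSum c j)) := by
    rw [← prod_ascPochhammer_laterSum hθ c, ← Finset.prod_mul_distrib, ← Finset.prod_mul_distrib]
    refine Finset.prod_congr rfl fun j _ => ?_
    rw [hfac j]
    have h1 := hb j
    have h2 := hH j
    have h3 := ascPochhammer_pos (tailSum c j) θ hθ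
    field_simp
  have hp := ascPochhammer_pos n θ hθ
  have hprod : 0 ≤ ∏ j, 1 / ((c.blocksFun j : ℝ) * genHarmonic θ (tailSum c j)) :=
    Finset.prod_nonneg fun j _ => by have := hb j; have := hH j; positivity
  rw [hsplit, gFormula, div_eq_mul_one_div, ← mul_assoc, ← mul_assoc]
  gcongr

variable {Ω : Type*} [MeasurableSpace Ω] {P : Measure Ω} [IsProbabilityMeasure P]
  {X : Ω → Set (ℝ × ℝ)} {T : ℕ → ℕ → Ω → ℝ}

/-- The event that for some labelling the sample fills cells of the grid of mesh `1/(m+1)` as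
prescribed by the composition. -/
def gridEvent (T : ℕ → ℕ → Ω → ℝ) {n : ℕ} (c : Composition n) (m : ℕ) : Set (Ω × (Fin n → ℝ)) :=
  ⋃ σ ∈ labellings c, ⋃ d : Fin c.length → ℕ, cellEvent (T m) σ (cellIndex d)

theorem measurableSet_gridEvent (hTm : ∀ m k, Measurable (T m k)) {n : ℕ} (c : Composition n)
    (m : ℕ) : MeasurableSet (gridEvent T c m) :=
  Finset.measurableSet_biUnion _ fun σ _ => MeasurableSet.iUnion fun _ =>
    measurableSet_cellEvent (hTm m) σ _

/-- Summing the probabilities of the cell events over the gaps `d` gives a product of geometric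
series. -/
theorem card_mul_prod_le_measureReal_gridEvent (hθ : 0 < θ)
    (hX : IsPoissonProcess P X (stripIntensity θ)) (hTm : ∀ m k, Measurable (T m k))
    (hmono : ∀ m ω, Monotone fun k => T m k ω) (h01 : ∀ m k ω, T m k ω ∈ Icc (0 : ℝ) 1)
    (hT : ∀ᵐ ω ∂P, IsRegular (X ω) ∧
        ∀ m k : ℕ, T m k ω = subordinator (X ω) (k / ((m : ℝ) + 1)))
    {n : ℕ} (c : Composition n) (m : ℕ) :
    (labellings c).card * ∏ j, (polyMean θ (1 / ((m : ℝ) + 1))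
        ((1 - Polynomial.X) ^ c.blocksFun j * Polynomial.X ^ laterSum c j) /
        (1 - Real.exp (-(1 / ((m : ℝ) + 1) * genHarmonic θ (tailSum c j)))))
      ≤ (P.prod (Measure.pi fun _ : Fin n => unifLaw)).real (gridEvent T c m) := by
  set h : ℝ := 1 / ((m : ℝ) + 1) with hh
  have hh0 : 0 < h := by positivity
  set ρ : Fin c.length → ℝ := fun j => Real.exp (-(h * genHarmonic θ (tailSum c j))) with hρ
  set M : Fin c.length → ℝ := fun j =>
    polyMean θ h ((1 - Polynomial.X) ^ c.blocksFun j * Polynomial.X ^ laterSum c j)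
  have hρ1 : ∀ j, ρ j < 1 := fun j => by
    rw [hρ]
    simp only
    rw [Real.exp_lt_one_iff, neg_lt_zero]
    exact mul_pos hh0 (genHarmonic_pos hθ (by
      rw [tailSum_eq_add]; have := c.one_le_blocksFun j; omega))
  have hcell : ∀ σ ∈ labellings c, ∀ d : Fin c.length → ℕ,
      (P.prod (Measure.pi fun _ : Fin n => unifLaw)).real (cellEvent (T m) σ (cellIndex d))
        = ∏ j, ρ j ^ d j * M j := by
    intro σ hσ d
    rw [measureReal_cellEvent (hTm m) (hmono m) (h01 m) hσ,
      ← integral_prod_cell_length_pow hθ hX hh0.le c d]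
    refine integral_congr_ae ?_
    filter_upwards [hT] with ω hω
    refine Finset.prod_congr rfl fun j _ => ?_
    rw [hω.2, hω.2, startIndex_succ, hh, mul_one_div, mul_one_div]
  have hN : ∀ N : ℕ, (labellings c).card * ∏ j, ∑ k ∈ Finset.range N, ρ j ^ k * M j
      ≤ (P.prod (Measure.pi fun _ : Fin n => unifLaw)).real (gridEvent T c m) := by
    intro N
    set I := labellings c ×ˢ Fintype.piFinset fun _ : Fin c.length => Finset.range N
    have hsub : (⋃ x ∈ I, cellEvent (T m) x.1 (cellIndex x.2)) ⊆ gridEvent T c m := by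
      refine iUnion₂_subset fun x hx z hz => ?_
      exact mem_iUnion₂.mpr ⟨x.1, (Finset.mem_product.mp hx).1, mem_iUnion.mpr ⟨x.2, hz⟩⟩
    refine le_trans (le_of_eq ?_) (measureReal_mono hsub (measure_ne_top _ _))
    rw [measureReal_biUnion_finset (fun x hx y hy hxy =>
        disjoint_cellEvent (hmono m) (Finset.mem_product.mp hx).1 (Finset.mem_product.mp hy).1 hxy)
      (fun x _ => measurableSet_cellEvent (hTm m) _ _), Finset.sum_product]
    rw [Finset.sum_congr rfl fun σ hσ => Finset.sum_congr rfl fun d _ => hcell σ hσ d,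
      Finset.sum_const, nsmul_eq_mul, Finset.prod_univ_sum]
  have hlim : Tendsto (fun N => (labellings c).card * ∏ j, ∑ k ∈ Finset.range N, ρ j ^ k * M j)
      atTop (𝓝 ((labellings c).card * ∏ j, M j / (1 - ρ j))) := by
    refine (tendsto_finsetProd _ fun j _ => ?_).const_mul _
    have := ((hasSum_geometric_of_lt_one (Real.exp_pos _).le (hρ1 j)).mul_right
      (M j)).tendsto_sum_nat
    rwa [inv_mul_eq_div] at this
  exact le_of_tendsto' hlim hN

theorem tendsto_card_mul_prod (hθ : 0 < θ) {n : ℕ} (c : Composition n) :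
    Tendsto (fun m : ℕ => (labellings c).card * ∏ j, (polyMean θ (1 / ((m : ℝ) + 1))
        ((1 - Polynomial.X) ^ c.blocksFun j * Polynomial.X ^ laterSum c j) /
        (1 - Real.exp (-(1 / ((m : ℝ) + 1) * genHarmonic θ (tailSum c j)))))) atTop
      (𝓝 ((labellings c).card * ∏ j, ((c.blocksFun j - 1).factorial *
        (ascPochhammer ℝ (laterSum c j)).eval θ / (ascPochhammer ℝ (tailSum c j)).eval θ /
        genHarmonic θ (tailSum c j)))) := by
  refine (tendsto_finsetProd _ fun j _ => ?_).const_mul _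
  have hH : 0 < genHarmonic θ (tailSum c j) :=
    genHarmonic_pos hθ (by rw [tailSum_eq_add]; have := c.one_le_blocksFun j; omega)
  have hnum := tendsto_polyMean_div hθ (c.blocksFun j - 1) (laterSum c j)
  have hb : c.blocksFun j - 1 + 1 = c.blocksFun j := Nat.sub_add_cancel (c.one_le_blocksFun j)
  have ht : c.blocksFun j - 1 + laterSum c j + 1 = tailSum c j := by
    rw [tailSum_eq_add]; omega
  rw [hb, ht] at hnum
  have hden := (tendsto_mul_exp_sub_one (genHarmonic θ (tailSum c j))).neg
  rw [neg_neg] at hden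
  refine (hnum.div hden hH.ne').congr fun m => ?_
  have hm : (m : ℝ) + 1 ≠ 0 := by positivity
  rw [Pi.div_apply, ← mul_neg, neg_sub, mul_div_mul_left _ _ hm]

theorem represents_gFormula (hθ : 0 < θ) (hX : IsPoissonProcess P X (stripIntensity θ)) :
    Represents P (fun ω => rangeComplement (X ω)) (gFormula θ) := by
  obtain ⟨T, hTm, hmono, h01, hT⟩ := exists_gridPath hθ hX
  have key : ∀ (n : ℕ) (c : Composition n),
      NullMeasurableSet (sampleEvent (fun ω => rangeComplement (X ω)) n c)
        (P.prod (Measure.pi fun _ : Fin n => unifLaw)) ∧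
      (P.prod (Measure.pi fun _ : Fin n => unifLaw))
        (sampleEvent (fun ω => rangeComplement (X ω)) n c) = ENNReal.ofReal (gFormula θ n c) := by
    intro n
    refine measure_preimage_eq_of_sum_eq_one
      (D := fun z : Ω × (Fin n → ℝ) => sampleComposition (rangeComplement (X z.1)) z.2)
      (F := fun c => ⋂ M : ℕ, ⋃ m : ℕ, ⋃ _ : M ≤ m, gridEvent T c m)
      (fun c => MeasurableSet.iInter fun M => MeasurableSet.iUnion fun m =>
        MeasurableSet.iUnion fun _ => measurableSet_gridEvent hTm c m)
      (fun c => ?_) (sum_gFormula hθ n) (fun c => ?_)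
    · filter_upwards [ae_sampleComposition_eq hTm hT c] with z hz hmem
      refine hz (frequently_atTop.mpr fun M => ?_)
      obtain ⟨m, hm⟩ := mem_iUnion.mp (mem_iInter.mp hmem M)
      obtain ⟨hMm, hm⟩ := mem_iUnion.mp hm
      obtain ⟨σ, hσ, hm⟩ := mem_iUnion₂.mp hm
      obtain ⟨d, hd⟩ := mem_iUnion.mp hm
      exact ⟨m, hMm, σ, hσ, _, strictMono_cellIndex d, hd⟩
    · exact (gFormula_le_card_mul_prod hθ c).trans
        (le_measureReal_limsup (measurableSet_gridEvent hTm c) (tendsto_card_mul_prod hθ c)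
          (card_mul_prod_le_measureReal_gridEvent hθ hX hTm hmono h01 hT c))
  exact ⟨fun n c => (key n c).1, fun n c => (key n c).2⟩

end Sampling

end SamplingFormula

end

theorem theorem4 {Ω : Type*} [MeasurableSpace Ω] (P : Measure Ω) [IsProbabilityMeasure P]
    (θ : ℝ) (hθ : 0 < θ) (X : Ω → Set (ℝ × ℝ))
    (hX : SamplingFormula.IsPoissonProcess P X (SamplingFormula.stripIntensity θ)) :
    -- the complement of the closure of the range is a paintbox
    SamplingFormula.IsPaintbox P (fun ω => SamplingFormula.rangeComplement (X ω)) ∧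
    -- `g` is a composition structure
    SamplingFormula.IsCompositionStructure (SamplingFormula.gFormula θ) ∧
    -- sampling from the paintbox yields `g`
    SamplingFormula.Represents P (fun ω => SamplingFormula.rangeComplement (X ω))
      (SamplingFormula.gFormula θ) ∧
    -- `g` has the product form given by the binomial moments of the measure
    ∀ (n : ℕ) (c : Composition n),
      SamplingFormula.gFormula θ n c =
        ∏ j : Fin c.length,
          SamplingFormula.decrement (SamplingFormula.breakMeasure θ)
            (SamplingFormula.tailSum c j) (c.blocksFun j) :=
  ⟨SamplingFormula.isPaintbox_rangeComplement hθ hX,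
    SamplingFormula.isCompositionStructure_gFormula hθ,
    SamplingFormula.represents_gFormula hθ hX,
    SamplingFormula.gFormula_eq_prod_decrement hθ⟩
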